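/- Let $n\ge 1$ be an integer and $1<p<\infty$. For an open set $\mathcal O\subset\mathbb R^n$ let $W^{2,p}(\mathcal O)$ be the Sobolev space of complex-valued $f\in L^p(\mathcal O)$ whose weak derivatives $D^\alpha f$, $|\alpha|\le 2$, belong to $L^p(\mathcal O)$, with the norm $\bigl(\sum_{|\alpha|\le 2}\|D^\alpha f\|_{L^p(\mathcal O)}^p\bigr)^{1/p}$. Let $W^{2,p}_0(\mathbb R^n\setminus\{0\})$ be the closure of $C_0^\infty(\mathbb R^n\setminus\{0\})$ in $W^{2,p}(\mathbb R^n\setminus\{0\})$, and identify $f\in W^{2,p}(\mathbb R^n)$ with its restriction to $\mathbb R^n\setminus\{0\}$. (i) If $p\le \frac n2$, then $W^{2,p}_0(\mathbb R^n\setminus\{0\})=W^{2,p}(\mathbb R^n)$. (ii) If $\frac n2<p\le n$, then every $f\in W^{2,p}(\mathbb R^n)$ has a unique continuous representative, and, with $f(0)$ denoting its value at $0$, $$W^{2,p}_0(\mathbb R^n\setminus\{0\})=\{f\in W^{2,p}(\mathbb R^n): f(0)=0\}.$$ (iii) If $p>n$, then every $f\in W^{2,p}(\mathbb R^n)$ has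 a unique $C^1$ representative, and, with $f(0)$ and $D_if(0)$ denoting the values at $0$ of this representative and of its partial derivatives, $$W^{2,p}_0(\mathbb R^n\setminus\{0\})=\{f\in W^{2,p}(\mathbb R^n): f(0)=0,\ D_if(0)=0\text{ for } i=1,\dots,n\}.$$ In each case the closure of $C_0^\infty(\mathbb R^n\setminus\{0\})$ in $W^{2,p}(\mathbb R^n)$ is the same set. -/

import Mathlib

open MeasureTheory Set TopologicalSpace
open scoped ENNReal ContDiff

noncomputable section

/-- The Euclidean space `ℝⁿ`. -/
abbrev RSpace (n : ℕ) : Type := EuclideanSpace ℝ (Fin n)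

/-- The multi-indices `α ∈ ℕⁿ` with `|α| = α₁ + … + αₙ ≤ k`. -/
abbrev MultiIdx (n k : ℕ) : Type :=
  {α : Fin n → ℕ // α ∈ (Finset.Iic (fun _ : Fin n => k)).filter (fun α => ∑ i, α i ≤ k)}

/-- Membership is exactly `|α| ≤ k`: the bounding box is only there to make the type finite. -/
theorem mem_multiIdx_iff {n k : ℕ} (α : Fin n → ℕ) :
    α ∈ (Finset.Iic (fun _ : Fin n => k)).filter (fun α => ∑ i, α i ≤ k) ↔ ∑ i, α i ≤ k := by
  simp only [Finset.mem_filter, Finset.mem_Iic, and_iff_right_iff_imp]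
  intro h i
  exact (Finset.single_le_sum (fun j _ => Nat.zero_le (α j)) (Finset.mem_univ i)).trans h

/-- The classical partial derivative `∂φ/∂xᵢ`. -/
def partialDeriv {n : ℕ} (i : Fin n) (φ : RSpace n → ℂ) : RSpace n → ℂ :=
  fun x => fderiv ℝ φ x (EuclideanSpace.single i 1)

/-- The classical derivative `D^α φ = D₁^{α₁} ⋯ Dₙ^{αₙ} φ`. -/
def multiDeriv {n : ℕ} (α : Fin n → ℕ) (φ : RSpace n → ℂ) : RSpace n → ℂ :=
  (List.finRange n).foldr (fun i ψ => (partialDeriv i)^[α i] ψ) φ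

/-- `φ ∈ C₀^∞(Ω)`: complex-valued, smooth, with compact support contained in `Ω`. -/
structure IsTestFun {n : ℕ} (Ω : Opens (RSpace n)) (φ : RSpace n → ℂ) : Prop where
  contDiff : ContDiff ℝ ∞ φ
  hasCompactSupport : HasCompactSupport φ
  tsupport_subset : tsupport φ ⊆ Ω

/-- `v` is the weak derivative `D^α u` of `u` in the open set `Ω`. -/
def IsWeakDeriv {n : ℕ} (Ω : Opens (RSpace n)) (α : Fin n → ℕ) (u v : RSpace n → ℂ) : Prop :=
  ∀ φ : RSpace n → ℂ, IsTestFun Ω φ →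
    ∫ x in Ω, u x * multiDeriv α φ x = (-1) ^ (∑ i, α i) * ∫ x in Ω, v x * φ x

section Helpers

theorem smoothCompact_partialDeriv {n : ℕ} (i : Fin n) {φ : RSpace n → ℂ}
    (h : ContDiff ℝ ∞ φ ∧ HasCompactSupport φ) :
    ContDiff ℝ ∞ (partialDeriv i φ) ∧ HasCompactSupport (partialDeriv i φ) := by
  refine ⟨?_, h.2.fderiv_apply ℝ _⟩
  exact (h.1.fderiv_right (m := ∞) (by simp)).clm_apply contDiff_const

theorem smoothCompact_multiDeriv {n : ℕ} (α : Fin n → ℕ) {φ : RSpace n → ℂ}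
    (h : ContDiff ℝ ∞ φ ∧ HasCompactSupport φ) :
    ContDiff ℝ ∞ (multiDeriv α φ) ∧ HasCompactSupport (multiDeriv α φ) := by
  unfold multiDeriv
  induction List.finRange n with
  | nil => exact h
  | cons i l ih =>
    simp only [List.foldr_cons]
    generalize α i = m
    induction m with
    | zero => exact ih
    | succ m ihm =>
      rw [Function.iterate_succ_apply']
      exact smoothCompact_partialDeriv i ihm

variable {n k : ℕ} {p : ℝ≥0∞} [Fact (1 ≤ p)] {Ω : Opens (RSpace n)}

theorem integrable_lp_mul (f : Lp ℂ p (volume.restrict (Ω : Set (RSpace n))))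
    {ψ : RSpace n → ℂ} (h : ContDiff ℝ ∞ ψ ∧ HasCompactSupport ψ) :
    IntegrableOn (fun x => f x * ψ x) Ω := by
  have hf : LocallyIntegrable f (volume.restrict (Ω : Set (RSpace n))) :=
    (Lp.memLp f).locallyIntegrable Fact.out
  have := hf.integrable_smul_left_of_hasCompactSupport h.1.continuous h.2
  simpa [IntegrableOn, smul_eq_mul, mul_comm] using this

theorem IsWeakDeriv.add {α : Fin n → ℕ}
    {f f' g g' : Lp ℂ p (volume.restrict (Ω : Set (RSpace n)))}
    (h : IsWeakDeriv Ω α f g) (h' : IsWeakDeriv Ω α f' g') :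
    IsWeakDeriv Ω α (f + f' : Lp ℂ p (volume.restrict (Ω : Set (RSpace n))))
      (g + g' : Lp ℂ p (volume.restrict (Ω : Set (RSpace n)))) := by
  intro φ hφ
  have hs : ContDiff ℝ ∞ φ ∧ HasCompactSupport φ := ⟨hφ.1, hφ.2⟩
  have e : ∀ (a b : Lp ℂ p (volume.restrict (Ω : Set (RSpace n)))) (ψ : RSpace n → ℂ),
      (ContDiff ℝ ∞ ψ ∧ HasCompactSupport ψ) →
      ∫ x in Ω, (a + b : Lp ℂ p (volume.restrict (Ω : Set (RSpace n)))) x * ψ x =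
        (∫ x in Ω, a x * ψ x) + ∫ x in Ω, b x * ψ x := by
    intro a b ψ hψ
    rw [← integral_add (integrable_lp_mul a hψ) (integrable_lp_mul b hψ)]
    refine integral_congr_ae ?_
    filter_upwards [Lp.coeFn_add a b] with x hx
    rw [hx, Pi.add_apply, add_mul]
  rw [e _ _ _ (smoothCompact_multiDeriv α hs), e _ _ _ hs, h φ hφ, h' φ hφ, mul_add]

theorem IsWeakDeriv.smul {α : Fin n → ℕ} (c : ℂ)
    {f g : Lp ℂ p (volume.restrict (Ω : Set (RSpace n)))}
    (h : IsWeakDeriv Ω α f g) :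
    IsWeakDeriv Ω α (c • f : Lp ℂ p (volume.restrict (Ω : Set (RSpace n))))
      (c • g : Lp ℂ p (volume.restrict (Ω : Set (RSpace n)))) := by
  intro φ hφ
  have e : ∀ (a : Lp ℂ p (volume.restrict (Ω : Set (RSpace n)))) (ψ : RSpace n → ℂ),
      ∫ x in Ω, (c • a : Lp ℂ p (volume.restrict (Ω : Set (RSpace n)))) x * ψ x =
        c * ∫ x in Ω, a x * ψ x := by
    intro a ψ
    rw [← integral_const_mul]
    refine integral_congr_ae ?_
    filter_upwards [Lp.coeFn_smul c a] with x hx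
    rw [hx, Pi.smul_apply, smul_eq_mul, mul_assoc]
  rw [e, e, h φ hφ]
  ring

/-- The weak derivative is unique. -/
theorem IsWeakDeriv.unique {α : Fin n → ℕ} {u : RSpace n → ℂ}
    {g g' : Lp ℂ p (volume.restrict (Ω : Set (RSpace n)))}
    (h : IsWeakDeriv Ω α u g) (h' : IsWeakDeriv Ω α u g') : g = g' := by
  have hl : LocallyIntegrable (fun x => g x - g' x) (volume.restrict (Ω : Set (RSpace n))) :=
    ((Lp.memLp g).locallyIntegrable Fact.out).sub ((Lp.memLp g').locallyIntegrable Fact.out)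
  have key := Ω.isOpen.ae_eq_zero_of_integral_contDiff_smul_eq_zero
    (μ := volume.restrict (Ω : Set (RSpace n))) (hl.locallyIntegrableOn _) (by
      intro φ h1 h2 h3
      have hc : HasCompactSupport (fun x => (φ x : ℂ)) := h2.comp_left (g := fun t : ℝ => (t : ℂ))
        Complex.ofReal_zero
      have ht : IsTestFun Ω (fun x => (φ x : ℂ)) :=
        ⟨Complex.ofRealCLM.contDiff.comp h1, hc,
          (closure_mono (Function.support_comp_subset Complex.ofReal_zero φ)).trans h3⟩
      have hh := (h _ ht).symm.trans (h' _ ht)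
      have hh2 := mul_left_cancel₀ (pow_ne_zero _ (neg_ne_zero.mpr one_ne_zero)) hh
      have hi := integrable_lp_mul g ⟨ht.1, ht.2⟩
      have hi' := integrable_lp_mul g' ⟨ht.1, ht.2⟩
      have : ∀ x, φ x • (g x - g' x) = g x * (φ x : ℂ) - g' x * (φ x : ℂ) := by
        intro x
        rw [Complex.real_smul]
        ring
      simp only [this]
      rw [integral_sub hi hi', hh2, sub_self])
  refine Lp.ext ?_
  filter_upwards [key, ae_restrict_mem Ω.isOpen.measurableSet] with x hx hm
  exact sub_eq_zero.mp (hx hm)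

end Helpers

/-- The set underlying `W^{k,p}(Ω)`: all `f ∈ L^p(Ω)` whose weak derivatives `D^α f`, `|α| ≤ k`,
exist and belong to `L^p(Ω)`. -/
def sobolevSubmodule (n k : ℕ) (p : ℝ≥0∞) [Fact (1 ≤ p)] (Ω : Opens (RSpace n)) :
    Submodule ℂ (Lp ℂ p (volume.restrict (Ω : Set (RSpace n)))) where
  carrier := {f | ∀ α : MultiIdx n k, ∃ g : Lp ℂ p (volume.restrict (Ω : Set (RSpace n))),
    IsWeakDeriv Ω α.1 f g}
  add_mem' := by
    intro f f' hf hf' α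
    obtain ⟨g, hg⟩ := hf α
    obtain ⟨g', hg'⟩ := hf' α
    exact ⟨g + g', hg.add hg'⟩
  zero_mem' := by
    intro α
    refine ⟨0, ?_⟩
    intro φ hφ
    have e : ∀ ψ : RSpace n → ℂ,
        ∫ x in Ω, (0 : Lp ℂ p (volume.restrict (Ω : Set (RSpace n)))) x * ψ x = 0 := by
      intro ψ
      refine integral_eq_zero_of_ae ?_
      filter_upwards [Lp.coeFn_zero ℂ p (volume.restrict (Ω : Set (RSpace n)))] with x hx
      rw [hx]
      simp
    rw [e, e, mul_zero]
  smul_mem' := by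
    intro c f hf α
    obtain ⟨g, hg⟩ := hf α
    exact ⟨c • g, hg.smul c⟩

/-- The Sobolev space `W^{k,p}(Ω)` of complex-valued functions. It is a type of its own, so that it
carries the Sobolev norm below and not the norm of `L^p(Ω)`. -/
def SobolevSpace (n k : ℕ) (p : ℝ≥0∞) [Fact (1 ≤ p)] (Ω : Opens (RSpace n)) : Type :=
  sobolevSubmodule n k p Ω

namespace SobolevSpace

variable {n k : ℕ} {p : ℝ≥0∞} [Fact (1 ≤ p)] {Ω : Opens (RSpace n)}

instance instAddCommGroup : AddCommGroup (SobolevSpace n k p Ω) :=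
  inferInstanceAs (AddCommGroup (sobolevSubmodule n k p Ω))

instance instModule : Module ℂ (SobolevSpace n k p Ω) :=
  inferInstanceAs (Module ℂ (sobolevSubmodule n k p Ω))

/-- The inclusion `W^{k,p}(Ω) ⊆ L^p(Ω)`. -/
def toLp : SobolevSpace n k p Ω →ₗ[ℂ] Lp ℂ p (volume.restrict (Ω : Set (RSpace n))) :=
  (sobolevSubmodule n k p Ω).subtype

/-- A function representing the class `f ∈ W^{k,p}(Ω)`. -/
instance instCoeFun : CoeFun (SobolevSpace n k p Ω) (fun _ => RSpace n → ℂ) :=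
  ⟨fun f => (toLp f : RSpace n → ℂ)⟩

/-- The weak derivative `D^α f ∈ L^p(Ω)`, `|α| ≤ k`, of `f ∈ W^{k,p}(Ω)`. -/
def weakDeriv (α : MultiIdx n k) (f : SobolevSpace n k p Ω) :
    Lp ℂ p (volume.restrict (Ω : Set (RSpace n))) :=
  (f.2 α).choose

theorem isWeakDeriv (α : MultiIdx n k) (f : SobolevSpace n k p Ω) :
    IsWeakDeriv Ω α.1 f (weakDeriv α f) :=
  (f.2 α).choose_spec

/-- The map `f ↦ (D^α f)_{|α| ≤ k}` into the `ℓ^p`-product of copies of `L^p(Ω)`. -/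
def jet : SobolevSpace n k p Ω →ₗ[ℂ]
    PiLp p (fun _ : MultiIdx n k => Lp ℂ p (volume.restrict (Ω : Set (RSpace n)))) where
  toFun f := WithLp.toLp p (fun α => weakDeriv α f)
  map_add' f g := by
    ext1 α
    exact (isWeakDeriv α (f + g)).unique ((isWeakDeriv α f).add (isWeakDeriv α g))
  map_smul' c f := by
    ext1 α
    exact (isWeakDeriv α (c • f)).unique ((isWeakDeriv α f).smul c)

theorem multiDeriv_zero (φ : RSpace n → ℂ) : multiDeriv (0 : Fin n → ℕ) φ = φ := by
  unfold multiDeriv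
  induction List.finRange n with
  | nil => rfl
  | cons i l ih => simp [ih]

theorem jet_injective : Function.Injective (jet : SobolevSpace n k p Ω →ₗ[ℂ] _) := by
  intro f g h
  let z : MultiIdx n k := ⟨0, (mem_multiIdx_iff 0).mpr (by simp)⟩
  have e : ∀ f : SobolevSpace n k p Ω, weakDeriv z f = toLp f := by
    intro f
    refine (isWeakDeriv z f).unique ?_
    intro φ _
    simp [z, multiDeriv_zero]
  have h1 : weakDeriv z f = weakDeriv z g := congrArg (fun u => u z) h
  rw [e, e] at h1
  exact Subtype.ext h1

/-- The norm of `W^{k,p}(Ω)` (see `norm_eq` for the formula). -/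
instance instNormedAddCommGroup : NormedAddCommGroup (SobolevSpace n k p Ω) :=
  NormedAddCommGroup.induced _ _ (jet : SobolevSpace n k p Ω →ₗ[ℂ] _) jet_injective

instance instNormedSpace : NormedSpace ℂ (SobolevSpace n k p Ω) :=
  NormedSpace.induced ℂ _ _ (jet : SobolevSpace n k p Ω →ₗ[ℂ] _)

/-- `|f|_{k,p} = (∑_{|α| ≤ k} ‖D^α f‖_{L^p(Ω)}^p)^{1/p}`. -/
theorem norm_eq (hp : p ≠ ⊤) (f : SobolevSpace n k p Ω) :
    ‖f‖ = (∑ α : MultiIdx n k, ‖weakDeriv α f‖ ^ p.toReal) ^ (1 / p.toReal) := by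
  have h1 : (1 : ℝ≥0∞) ≤ p := Fact.out
  exact PiLp.norm_eq_sum (ENNReal.toReal_pos (zero_lt_one.trans_le h1).ne' hp) (jet f)

end SobolevSpace

/-- The copy of `C₀^∞(U)` inside `W^{k,p}(Ω)`, for an open set `U ⊆ Ω`. -/
def testFunctions {n : ℕ} (k : ℕ) (p : ℝ≥0∞) [Fact (1 ≤ p)] (U Ω : Opens (RSpace n)) :
    Set (SobolevSpace n k p Ω) :=
  {f | ∃ φ : RSpace n → ℂ, IsTestFun U φ ∧ f =ᵐ[volume.restrict (Ω : Set (RSpace n))] φ}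

/-- The space `W₀^{k,p}(Ω)`: the closure of `C₀^∞(Ω)` in `W^{k,p}(Ω)`. -/
def sobolevZero {n : ℕ} (k : ℕ) (p : ℝ≥0∞) [Fact (1 ≤ p)] (Ω : Opens (RSpace n)) :
    Set (SobolevSpace n k p Ω) :=
  closure (testFunctions k p Ω Ω)

/-- The open set `ℝⁿ ∖ {0}`. -/
def punctured (n : ℕ) : Opens (RSpace n) := ⟨{0}ᶜ, isOpen_compl_singleton⟩

/-- The image of a set `S ⊆ W^{k,p}(ℝⁿ)` under the restriction map `f ↦ f|_Ω` into
`W^{k,p}(Ω)`. -/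
def restrictions {n k : ℕ} {p : ℝ≥0∞} [Fact (1 ≤ p)] (Ω : Opens (RSpace n))
    (S : Set (SobolevSpace n k p (⊤ : Opens (RSpace n)))) : Set (SobolevSpace n k p Ω) :=
  {u | ∃ f ∈ S, f =ᵐ[volume.restrict (Ω : Set (RSpace n))] u}

/-- `{f ∈ W^{2,p}(ℝⁿ) : f(0) = 0}`, where `f(0)` is the value of the continuous representative
of `f` (two continuous representatives are equal). -/
def vanishingAtZero (n : ℕ) (p : ℝ≥0∞) [Fact (1 ≤ p)] :
    Set (SobolevSpace n 2 p (⊤ : Opens (RSpace n))) :=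
  {f | ∃ g : RSpace n → ℂ, Continuous g ∧ f =ᵐ[volume] g ∧ g 0 = 0}

/-- `{f ∈ W^{2,p}(ℝⁿ) : f(0) = 0, D₁f(0) = ⋯ = Dₙf(0) = 0}`, where the values at `0` are those of
the `C¹` representative of `f` and of its partial derivatives. -/
def vanishingToFirstOrderAtZero (n : ℕ) (p : ℝ≥0∞) [Fact (1 ≤ p)] :
    Set (SobolevSpace n 2 p (⊤ : Opens (RSpace n))) :=
  {f | ∃ g : RSpace n → ℂ, ContDiff ℝ 1 g ∧ f =ᵐ[volume] g ∧
    g 0 = 0 ∧ ∀ i, partialDeriv i g 0 = 0}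

end

/-! The closure is governed by which values at the origin depend continuously on `f` in the
`W^{2,p}` norm. For `2p > n` the norm controls `sup |φ|`, and for `p > n` also `sup |∇φ|`
(`exists_sobolev_bound_two`, `exists_sobolev_bound_one`). Hence a `W^{2,p}` limit of test functions
is a locally uniform, respectively `C¹`, limit. This yields the regular representative, and it shows
that limits of functions vanishing near `0` inherit the stated vanishing at `0`.

Conversely, test functions are dense in `W^{2,p}(ℝⁿ)`, by mollification and truncation. If `f`
vanishes at `0` to the required order, the corresponding Taylor coefficients at `0` of approximating
test functions `φ_j` tend to `0`. Subtracting the Taylor polynomial times a fixed cutoff therefore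
does not change the limit (`mem_closure_of_correction`), and it remains to approximate a test
function `φ` vanishing at `0` to order `m = 0, 1, 2` in the three cases.

That is `exists_testFun_punctured_approx`. With `s = 2 - m`, the derivatives of `χ(2ʲx) φ(x)` of
order at most `2` are `O(2^{js})` on an annulus `|x| ~ 2⁻ʲ` of volume `O(2^{-jn})`, so the `p`-th
power of their norm there is `O(2^{j(sp-n)})`. In the critical case `sp = n` this is bounded but
need not be small. The remedy is to average the cutoffs over the scales `N ≤ j < 2N`: the annuli are
disjoint, so the `p`-th powers add up to `O(N · N^{-p})`, which tends to `0` because `p > 1`.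

The space over `ℝⁿ ∖ {0}` is compared with the one over `ℝⁿ` in `sobolevZero_punctured`: the origin
is a null set, and weak derivatives of a limit of test functions are weak derivatives across the
origin. -/

noncomputable section

/-! ### Calculus of the classical derivatives `D^α` -/

section MultiDerivCalculus

variable {n : ℕ}

/-- Induction principle for `multiDeriv`: a property of families of functions which is preserved
by partial derivatives, with the order as a parameter. -/
theorem multiDeriv_family_induction {ι : Type*} {R : ℕ → (ι → RSpace n → ℂ) → Prop}
    {Φ : ι → RSpace n → ℂ} (h0 : R 0 Φ)
    (hs : ∀ i k Ψ, R k Ψ → R (k + 1) (fun a => partialDeriv i (Ψ a))) (α : Fin n → ℕ) :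
    R (∑ i, α i) (fun a => multiDeriv α (Φ a)) := by
  have key : ∀ l : List (Fin n), R (l.map α).sum
      (fun a => l.foldr (fun i ψ => (partialDeriv i)^[α i] ψ) (Φ a)) := by
    intro l
    induction l with
    | nil => exact h0
    | cons i l ih =>
      simp only [List.foldr_cons, List.map_cons, List.sum_cons]
      generalize α i = m
      induction m with
      | zero => simpa using ih
      | succ m ihm =>
        have := hs i _ _ ihm
        simp only [Function.iterate_succ_apply']
        convert this using 1
        ring
  have := key (List.finRange n)
  rwa [← List.ofFn_eq_map, List.sum_ofFn] at this

/-- Induction principle for `multiDeriv` of one function. -/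
theorem multiDeriv_induction {R : ℕ → (RSpace n → ℂ) → Prop} {φ : RSpace n → ℂ} (h0 : R 0 φ)
    (hs : ∀ i k ψ, R k ψ → R (k + 1) (partialDeriv i ψ)) (α : Fin n → ℕ) :
    R (∑ i, α i) (multiDeriv α φ) :=
  multiDeriv_family_induction (ι := Unit) (R := fun k Ψ => R k (Ψ ())) (Φ := fun _ => φ) h0
    (fun i k _ h => hs i k _ h) α

theorem ContDiff.partialDeriv {φ : RSpace n → ℂ} (h : ContDiff ℝ ∞ φ) (i : Fin n) :
    ContDiff ℝ ∞ (partialDeriv i φ) :=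
  (h.fderiv_right (m := ∞) (by simp)).clm_apply contDiff_const

theorem ContDiff.multiDeriv {φ : RSpace n → ℂ} (h : ContDiff ℝ ∞ φ) (α : Fin n → ℕ) :
    ContDiff ℝ ∞ (multiDeriv α φ) :=
  multiDeriv_induction (R := fun _ ψ => ContDiff ℝ ∞ ψ) h (fun i _ _ h => h.partialDeriv i) α

theorem partialDeriv_comm {φ : RSpace n → ℂ} (h : ContDiff ℝ ∞ φ) (i j : Fin n) :
    partialDeriv i (partialDeriv j φ) = partialDeriv j (partialDeriv i φ) := by
  have hd : Differentiable ℝ (fderiv ℝ φ) :=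
    (h.fderiv_right (m := ∞) (by simp)).differentiable (by simp)
  have e : ∀ (i j : Fin n) x, partialDeriv i (partialDeriv j φ) x =
      fderiv ℝ (fderiv ℝ φ) x (EuclideanSpace.single i 1) (EuclideanSpace.single j 1) := by
    intro i j x
    have := ((hd x).hasFDerivAt.clm_apply
      (hasFDerivAt_const (EuclideanSpace.single j (1 : ℝ)) x)).fderiv
    unfold partialDeriv
    rw [this]
    simp
  funext x
  rw [e, e]
  exact (h.contDiffAt.isSymmSndFDerivAt (by
    rw [minSmoothness_of_isRCLikeNormedField]
    exact WithTop.coe_le_coe.2 (le_top : (2 : ℕ∞) ≤ ⊤))) _ _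

/-- The fold applies the partial derivatives in a fixed order, so the extra `D_i` appears at the
place of `i` and has to be commuted outwards past the derivatives applied later. Absence of
duplicates ensures that it appears only once. -/
theorem multiDeriv_add_single {φ : RSpace n → ℂ} (h : ContDiff ℝ ∞ φ) (i : Fin n)
    (α : Fin n → ℕ) :
    multiDeriv (α + Pi.single i 1) φ = partialDeriv i (multiDeriv α φ) := by
  have key : ∀ l : List (Fin n), l.Nodup →
      l.foldr (fun j ψ => (partialDeriv j)^[(α + Pi.single i 1 : Fin n → ℕ) j] ψ) φ =
        if i ∈ l then partialDeriv i (l.foldr (fun j ψ => (partialDeriv j)^[α j] ψ) φ)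
        else l.foldr (fun j ψ => (partialDeriv j)^[α j] ψ) φ := by
    intro l hl
    induction l with
    | nil => simp
    | cons j l ih =>
      rw [List.nodup_cons] at hl
      simp only [List.foldr_cons, ih hl.2]
      by_cases hij : j = i
      · subst hij
        simp [hl.1, Function.iterate_succ_apply']
      · have hij' : i ≠ j := fun h => hij h.symm
        simp only [Pi.add_apply, Pi.single_apply, hij, if_false, add_zero, List.mem_cons, hij',
          false_or]
        split_ifs with hm
        · have hsm : ContDiff ℝ ∞ (l.foldr (fun j ψ => (partialDeriv j)^[α j] ψ) φ) := by
            clear ih hm hl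
            induction l with
            | nil => exact h
            | cons a l ih =>
              simp only [List.foldr_cons]
              generalize α a = m
              induction m with
              | zero => exact ih
              | succ m ihm =>
                rw [Function.iterate_succ_apply']
                exact ihm.partialDeriv a
          generalize l.foldr (fun j ψ => (partialDeriv j)^[α j] ψ) φ = ψ at hsm
          generalize α j = m
          have : ContDiff ℝ ∞ ((partialDeriv j)^[m] ψ) ∧ (partialDeriv j)^[m] (partialDeriv i ψ) =
              partialDeriv i ((partialDeriv j)^[m] ψ) := by
            induction m with
            | zero => exact ⟨hsm, rfl⟩
            | succ m ihm =>
              rw [Function.iterate_succ_apply', Function.iterate_succ_apply']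
              exact ⟨ihm.1.partialDeriv j, by rw [ihm.2, partialDeriv_comm ihm.1]⟩
          exact this.2
        · rfl
  have := key (List.finRange n) (List.nodup_finRange n)
  rwa [if_pos (List.mem_finRange i)] at this

theorem multiDeriv_single {φ : RSpace n → ℂ} (h : ContDiff ℝ ∞ φ) (i : Fin n) :
    multiDeriv (Pi.single i 1) φ = partialDeriv i φ := by
  have := multiDeriv_add_single h i 0
  rwa [zero_add, SobolevSpace.multiDeriv_zero] at this

theorem norm_iteratedFDeriv_partialDeriv_le {φ : RSpace n → ℂ} (h : ContDiff ℝ ∞ φ) (i : Fin n)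
    (l : ℕ) (x : RSpace n) :
    ‖iteratedFDeriv ℝ l (partialDeriv i φ) x‖ ≤ ‖iteratedFDeriv ℝ (l + 1) φ x‖ := by
  have h1 : ContDiff ℝ ∞ (fderiv ℝ φ) := h.fderiv_right (m := ∞) (by simp)
  refine (norm_iteratedFDeriv_clm_apply_const (n := l) h1.contDiffAt
    (by exact_mod_cast le_top)).trans ?_
  rw [norm_iteratedFDeriv_fderiv]
  simp

theorem norm_multiDeriv_le {φ : RSpace n → ℂ} (h : ContDiff ℝ ∞ φ) (α : Fin n → ℕ)
    (x : RSpace n) : ‖multiDeriv α φ x‖ ≤ ‖iteratedFDeriv ℝ (∑ i, α i) φ x‖ := by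
  -- The bound is carried for every order `l`, because each further partial derivative uses up one
  -- order of the bound for its argument.
  have := multiDeriv_induction
    (R := fun k ψ => ContDiff ℝ ∞ ψ ∧ ∀ l,
      ‖iteratedFDeriv ℝ l ψ x‖ ≤ ‖iteratedFDeriv ℝ (l + k) φ x‖) (φ := φ)
    ⟨h, fun l => le_rfl⟩ (fun i k ψ hψ => ⟨hψ.1.partialDeriv i, fun l =>
      (norm_iteratedFDeriv_partialDeriv_le hψ.1 i l x).trans ((hψ.2 (l + 1)).trans_eq (by
        rw [show l + 1 + k = l + (k + 1) by ring]))⟩) α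
  have h0 := this.2 0
  rwa [norm_iteratedFDeriv_zero, zero_add] at h0

theorem multiDeriv_eqOn {φ φ' : RSpace n → ℂ} {U : Set (RSpace n)} (hU : IsOpen U)
    (h : EqOn φ φ' U) (α : Fin n → ℕ) : EqOn (multiDeriv α φ) (multiDeriv α φ') U := by
  -- A family indexed by `Bool` carries both functions through the same sequence of partial
  -- derivatives; the lemmas below use the same device with other index types.
  have := multiDeriv_family_induction (ι := Bool)
    (R := fun _ Ψ => EqOn (Ψ false) (Ψ true) U)
    (Φ := fun b => if b then φ' else φ) (by simpa using h)
    (fun j _ Ψ hΨ x hx => by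
      have : Ψ false =ᶠ[nhds x] Ψ true := hΨ.eventuallyEq_of_mem (hU.mem_nhds hx)
      simp only [partialDeriv]
      rw [this.fderiv_eq]) α
  simpa using this

theorem multiDeriv_zero_fun (α : Fin n → ℕ) : multiDeriv α (0 : RSpace n → ℂ) = 0 :=
  multiDeriv_induction (R := fun _ ψ => ψ = 0) rfl (fun i _ ψ h => by
    subst h
    funext x
    simp [partialDeriv]) α

theorem multiDeriv_eq_zero_of_notMem_tsupport {φ : RSpace n → ℂ} (α : Fin n → ℕ) {x : RSpace n}
    (hx : x ∉ tsupport φ) : multiDeriv α φ x = 0 := by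
  have := multiDeriv_eqOn (φ := φ) (φ' := 0) (isClosed_tsupport φ).isOpen_compl
    (fun y hy => image_eq_zero_of_notMem_tsupport hy) α hx
  rw [this, multiDeriv_zero_fun, Pi.zero_apply]

theorem multiDeriv_sub {φ ψ : RSpace n → ℂ} (hφ : ContDiff ℝ ∞ φ) (hψ : ContDiff ℝ ∞ ψ)
    (α : Fin n → ℕ) (x : RSpace n) :
    multiDeriv α (fun x => φ x - ψ x) x = multiDeriv α φ x - multiDeriv α ψ x := by
  have := multiDeriv_family_induction (ι := Fin 3)
    (R := fun _ Ψ => ContDiff ℝ ∞ (Ψ 0) ∧ ContDiff ℝ ∞ (Ψ 1) ∧ Ψ 2 = fun x => Ψ 0 x - Ψ 1 x)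
    (Φ := ![φ, ψ, fun x => φ x - ψ x]) ⟨by simpa using hφ, by simpa using hψ, by simp⟩
    (fun j _ Ψ hΨ => ⟨hΨ.1.partialDeriv j, hΨ.2.1.partialDeriv j, by
      funext x
      simp only [partialDeriv, hΨ.2.2]
      rw [fderiv_fun_sub (hΨ.1.differentiable (by simp) x) (hΨ.2.1.differentiable (by simp) x)]
      rfl⟩) α
  simpa using congrFun this.2.2 x

theorem multiDeriv_sum_const_mul {ι : Type*} (s : Finset ι) (c : ι → ℂ) {φ : ι → RSpace n → ℂ}
    (hφ : ∀ a, ContDiff ℝ ∞ (φ a)) (α : Fin n → ℕ) (x : RSpace n) :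
    multiDeriv α (fun x => ∑ a ∈ s, c a * φ a x) x = ∑ a ∈ s, c a * multiDeriv α (φ a) x := by
  have := multiDeriv_family_induction (ι := Option ι)
    (R := fun _ Ψ => (∀ a, ContDiff ℝ ∞ (Ψ (some a))) ∧
      Ψ none = fun x => ∑ a ∈ s, c a * Ψ (some a) x)
    (Φ := fun o => o.elim (fun x => ∑ a ∈ s, c a * φ a x) φ) ⟨hφ, rfl⟩
    (fun j _ Ψ hΨ => ⟨fun a => (hΨ.1 a).partialDeriv j, by
      funext x
      simp only [partialDeriv, hΨ.2]
      rw [fderiv_fun_sum (fun a _ => ((hΨ.1 a).differentiable (by simp) x).const_mul (c a))]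
      simp only [sum_apply]
      refine Finset.sum_congr rfl fun a _ => ?_
      rw [fderiv_const_mul ((hΨ.1 a).differentiable (by simp) x)]
      rfl⟩) α
  simpa using congrFun this.2 x

theorem multiDeriv_comp_const_sub {φ : RSpace n → ℂ} (hφ : ContDiff ℝ ∞ φ)
    (α : Fin n → ℕ) (x y : RSpace n) :
    multiDeriv α (fun y => φ (x - y)) y = (-1) ^ (∑ i, α i) * multiDeriv α φ (x - y) := by
  have := multiDeriv_family_induction (ι := Bool)
    (R := fun k Ψ => ContDiff ℝ ∞ (Ψ false) ∧ Ψ true = fun y => (-1) ^ k * Ψ false (x - y))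
    (Φ := fun b => if b then fun y => φ (x - y) else φ) ⟨by simpa using hφ, by simp⟩
    (fun j k Ψ hΨ => ⟨hΨ.1.partialDeriv j, by
      funext y
      have hd : DifferentiableAt ℝ (Ψ false) (x - y) := hΨ.1.differentiable (by simp) _
      have h2 : HasFDerivAt (fun y => Ψ false (x - y))
          ((fderiv ℝ (Ψ false) (x - y)).comp (-ContinuousLinearMap.id ℝ (RSpace n))) y :=
        hd.hasFDerivAt.comp y ((hasFDerivAt_id y).const_sub x)
      simp only [partialDeriv, hΨ.2]
      rw [(h2.const_mul ((-1 : ℂ) ^ k)).fderiv]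
      simp [pow_succ]⟩) α
  simpa using congrFun this.2 y

theorem integral_mul_partialDeriv {u φ : RSpace n → ℂ} (hu : ContDiff ℝ ∞ u)
    (hφ : ContDiff ℝ ∞ φ ∧ HasCompactSupport φ) (i : Fin n) :
    ∫ x, u x * partialDeriv i φ x = -∫ x, partialDeriv i u x * φ x := by
  have hφ' := smoothCompact_partialDeriv i hφ
  exact integral_mul_fderiv_eq_neg_fderiv_mul_of_integrable
    (((hu.partialDeriv i).continuous.mul hφ.1.continuous).integrable_of_hasCompactSupport
      hφ.2.mul_left)
    ((hu.continuous.mul hφ'.1.continuous).integrable_of_hasCompactSupport hφ'.2.mul_left)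
    ((hu.continuous.mul hφ.1.continuous).integrable_of_hasCompactSupport hφ.2.mul_left)
    (fun x _ => hu.differentiable (by simp) x) (fun x _ => hφ.1.differentiable (by simp) x)

theorem integral_mul_multiDeriv {u φ : RSpace n → ℂ} (hu : ContDiff ℝ ∞ u)
    (hφ : ContDiff ℝ ∞ φ ∧ HasCompactSupport φ) (α : Fin n → ℕ) :
    ∫ x, u x * multiDeriv α φ x = (-1) ^ (∑ i, α i) * ∫ x, multiDeriv α u x * φ x := by
  -- The family is indexed by all functions, so that `Ψ` is the operator built so far. Integration
  -- by parts moves the outermost `D_j` first and produces `Ψ (D_j u)`; the commutation clause turns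
  -- it into `D_j (Ψ u)`.
  have := multiDeriv_family_induction (ι := RSpace n → ℂ)
    (R := fun k Ψ => (∀ u, ContDiff ℝ ∞ u → ContDiff ℝ ∞ (Ψ u)) ∧
      (∀ u, ContDiff ℝ ∞ u ∧ HasCompactSupport u → HasCompactSupport (Ψ u)) ∧
      (∀ i u, ContDiff ℝ ∞ u → partialDeriv i (Ψ u) = Ψ (partialDeriv i u)) ∧
      ∀ u φ, ContDiff ℝ ∞ u → ContDiff ℝ ∞ φ ∧ HasCompactSupport φ →
        ∫ x, u x * Ψ φ x = (-1) ^ k * ∫ x, Ψ u x * φ x)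
    (Φ := id) ⟨fun u h => h, fun u h => h.2, fun i u _ => rfl, fun u φ _ _ => by simp⟩
    (fun j k Ψ hΨ => ⟨fun u h => (hΨ.1 u h).partialDeriv j,
      fun u h => (smoothCompact_partialDeriv j ⟨hΨ.1 u h.1, hΨ.2.1 u h⟩).2,
      fun i u h => by rw [partialDeriv_comm (hΨ.1 u h), hΨ.2.2.1 i u h], fun u φ hu hφ => by
        rw [integral_mul_partialDeriv hu ⟨hΨ.1 φ hφ.1, hΨ.2.1 φ hφ⟩,
          hΨ.2.2.2 _ φ (hu.partialDeriv j) hφ]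
        simp only [hΨ.2.2.1 j u hu]
        ring⟩) α
  exact this.2.2.2 u φ hu hφ

end MultiDerivCalculus

/-! ### Weak derivatives, convergence in `W^{k,p}`, and removal of the origin -/

section SobolevInterface

open Filter Topology

variable {n k : ℕ} {p : ℝ≥0∞} [Fact (1 ≤ p)] {Ω : Opens (RSpace n)}

theorem IsTestFun.mono {U V : Opens (RSpace n)} (h : U ≤ V) {φ : RSpace n → ℂ}
    (hφ : IsTestFun U φ) : IsTestFun V φ :=
  ⟨hφ.1, hφ.2, hφ.3.trans h⟩

theorem isTestFun_top {φ : RSpace n → ℂ} :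
    IsTestFun (⊤ : Opens (RSpace n)) φ ↔ ContDiff ℝ ∞ φ ∧ HasCompactSupport φ :=
  ⟨fun h => ⟨h.1, h.2⟩, fun h => ⟨h.1, h.2, fun _ _ => trivial⟩⟩

theorem IsTestFun.multiDeriv {φ : RSpace n → ℂ} (hφ : IsTestFun Ω φ) (α : Fin n → ℕ) :
    IsTestFun Ω (multiDeriv α φ) := by
  have h := smoothCompact_multiDeriv α ⟨hφ.1, hφ.2⟩
  refine ⟨h.1, h.2, subset_trans ?_ hφ.3⟩
  refine closure_minimal (fun x hx => ?_) (isClosed_tsupport φ)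
  by_contra hc
  exact hx (multiDeriv_eq_zero_of_notMem_tsupport α hc)

theorem memLp_of_smoothCompact {φ : RSpace n → ℂ} (h : ContDiff ℝ ∞ φ ∧ HasCompactSupport φ)
    (μ : Measure (RSpace n)) [IsFiniteMeasureOnCompacts μ] (q : ℝ≥0∞) : MemLp φ q μ :=
  h.1.continuous.memLp_of_hasCompactSupport h.2

/-- Functions that agree almost everywhere have the same weak derivatives. -/
theorem IsWeakDeriv.congr_ae {α : Fin n → ℕ} {u u' v v' : RSpace n → ℂ}
    (h : IsWeakDeriv Ω α u v) (hu : u =ᵐ[volume.restrict (Ω : Set (RSpace n))] u')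
    (hv : v =ᵐ[volume.restrict (Ω : Set (RSpace n))] v') : IsWeakDeriv Ω α u' v' := by
  intro φ hφ
  have e1 : ∫ x in Ω, u' x * _root_.multiDeriv α φ x = ∫ x in Ω, u x * _root_.multiDeriv α φ x :=
    integral_congr_ae (by filter_upwards [hu] with x hx; rw [hx])
  have e2 : ∫ x in Ω, v' x * φ x = ∫ x in Ω, v x * φ x :=
    integral_congr_ae (by filter_upwards [hv] with x hx; rw [hx])
  rw [e1, e2, h φ hφ]

theorem IsWeakDeriv.of_contDiff {φ : RSpace n → ℂ} (h : ContDiff ℝ ∞ φ) (α : Fin n → ℕ) :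
    IsWeakDeriv Ω α φ (_root_.multiDeriv α φ) := by
  intro ψ hψ
  have e : ∀ (u ψ : RSpace n → ℂ), IsTestFun Ω ψ → ∫ x in Ω, u x * ψ x = ∫ x, u x * ψ x := by
    intro u ψ hψ
    refine setIntegral_eq_integral_of_forall_compl_eq_zero fun x hx => ?_
    rw [image_eq_zero_of_notMem_tsupport fun hc => hx (hψ.3 hc), mul_zero]
  rw [e _ _ (hψ.multiDeriv α), e _ _ hψ, integral_mul_multiDeriv h ⟨hψ.1, hψ.2⟩]

namespace SobolevSpace

theorem ext_ae {f g : SobolevSpace n k p Ω}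
    (h : f =ᵐ[volume.restrict (Ω : Set (RSpace n))] g) : f = g :=
  Subtype.ext (Lp.ext h)

theorem weakDeriv_ae_eq {α : MultiIdx n k} {f : SobolevSpace n k p Ω} {g : RSpace n → ℂ}
    (hg : MemLp g p (volume.restrict (Ω : Set (RSpace n)))) (h : IsWeakDeriv Ω α.1 f g) :
    weakDeriv α f =ᵐ[volume.restrict (Ω : Set (RSpace n))] g := by
  have : weakDeriv α f = hg.toLp g :=
    (isWeakDeriv α f).unique (h.congr_ae (ae_eq_refl _) hg.coeFn_toLp.symm)
  rw [this]
  exact hg.coeFn_toLp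

theorem exists_of_memLp {f : RSpace n → ℂ} {g : MultiIdx n k → RSpace n → ℂ}
    (hf : MemLp f p (volume.restrict (Ω : Set (RSpace n))))
    (hg : ∀ α, MemLp (g α) p (volume.restrict (Ω : Set (RSpace n))))
    (h : ∀ α, IsWeakDeriv Ω α.1 f (g α)) :
    ∃ u : SobolevSpace n k p Ω, u =ᵐ[volume.restrict (Ω : Set (RSpace n))] f ∧
      ∀ α, weakDeriv α u =ᵐ[volume.restrict (Ω : Set (RSpace n))] g α := by
  have hw : ∀ α : MultiIdx n k, IsWeakDeriv Ω α.1 (hf.toLp f) (g α) := fun α =>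
    (h α).congr_ae hf.coeFn_toLp.symm (ae_eq_refl _)
  refine ⟨⟨hf.toLp f, fun α => ⟨(hg α).toLp (g α), (hw α).congr_ae (ae_eq_refl _)
    (hg α).coeFn_toLp.symm⟩⟩, hf.coeFn_toLp, fun α => ?_⟩
  exact weakDeriv_ae_eq (hg α) (hw α)

/-- The element of `W^{k,p}(Ω)` given by a smooth compactly supported function. -/
def ofSmooth (n k : ℕ) (p : ℝ≥0∞) [Fact (1 ≤ p)] (Ω : Opens (RSpace n)) {φ : RSpace n → ℂ}
    (h : ContDiff ℝ ∞ φ ∧ HasCompactSupport φ) : SobolevSpace n k p Ω :=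
  (exists_of_memLp (n := n) (k := k) (Ω := Ω) (memLp_of_smoothCompact h _ p)
    (fun α => memLp_of_smoothCompact (smoothCompact_multiDeriv α.1 h) _ p)
    (fun α => IsWeakDeriv.of_contDiff h.1 α.1)).choose

theorem ofSmooth_ae_eq {φ : RSpace n → ℂ} (h : ContDiff ℝ ∞ φ ∧ HasCompactSupport φ) :
    ofSmooth n k p Ω h =ᵐ[volume.restrict (Ω : Set (RSpace n))] φ :=
  (exists_of_memLp (n := n) (k := k) (Ω := Ω) (memLp_of_smoothCompact h _ p)
    (fun α => memLp_of_smoothCompact (smoothCompact_multiDeriv α.1 h) _ p)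
    (fun α => IsWeakDeriv.of_contDiff h.1 α.1)).choose_spec.1

theorem weakDeriv_ofSmooth_ae_eq {φ : RSpace n → ℂ} (h : ContDiff ℝ ∞ φ ∧ HasCompactSupport φ)
    (α : MultiIdx n k) : weakDeriv α (ofSmooth n k p Ω h)
      =ᵐ[volume.restrict (Ω : Set (RSpace n))] multiDeriv α.1 φ :=
  (exists_of_memLp (n := n) (k := k) (Ω := Ω) (memLp_of_smoothCompact h _ p)
    (fun α => memLp_of_smoothCompact (smoothCompact_multiDeriv α.1 h) _ p)
    (fun α => IsWeakDeriv.of_contDiff h.1 α.1)).choose_spec.2 α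

theorem norm_weakDeriv_le (α : MultiIdx n k) (f : SobolevSpace n k p Ω) :
    ‖weakDeriv α f‖ ≤ ‖f‖ :=
  PiLp.norm_apply_le (jet f) α

/-- The norm is pulled back along `jet`, and a finite `ℓ^p` product carries the product topology. -/
theorem tendsto_iff {ι : Type*} {l : Filter ι} {u : ι → SobolevSpace n k p Ω}
    {f : SobolevSpace n k p Ω} :
    Tendsto u l (𝓝 f) ↔
      ∀ α, Tendsto (fun j => eLpNorm (fun x => weakDeriv α (u j) x - weakDeriv α f x) p
        (volume.restrict (Ω : Set (RSpace n)))) l (𝓝 0) := by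
  have hiso : Isometry (jet : SobolevSpace n k p Ω →ₗ[ℂ] _) :=
    AddMonoidHomClass.isometry_of_norm _ fun f => rfl
  have hh := (PiLp.homeomorph p (fun _ : MultiIdx n k =>
    Lp ℂ p (volume.restrict (Ω : Set (RSpace n))))).isInducing
  rw [hiso.isEmbedding.tendsto_nhds_iff, hh.tendsto_nhds_iff, tendsto_pi_nhds]
  refine forall_congr' fun α => ?_
  exact Lp.tendsto_Lp_iff_tendsto_eLpNorm' _ _

theorem testFunctions_eq {U : Opens (RSpace n)} :
    testFunctions k p U Ω =
      {f | ∃ (φ : RSpace n → ℂ) (h : IsTestFun U φ), f = ofSmooth n k p Ω ⟨h.1, h.2⟩} := by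
  ext f
  constructor
  · rintro ⟨φ, h, hf⟩
    exact ⟨φ, h, ext_ae (hf.trans (ofSmooth_ae_eq ⟨h.1, h.2⟩).symm)⟩
  · rintro ⟨φ, h, rfl⟩
    exact ⟨φ, h, ofSmooth_ae_eq ⟨h.1, h.2⟩⟩

theorem mem_closure_testFunctions_iff {U : Opens (RSpace n)} {f : SobolevSpace n k p Ω} :
    f ∈ closure (testFunctions k p U Ω) ↔
      ∃ φ : ℕ → RSpace n → ℂ, (∀ j, IsTestFun U (φ j)) ∧ ∀ α : MultiIdx n k,
        Tendsto (fun j => eLpNorm (fun x => multiDeriv α.1 (φ j) x - weakDeriv α f x) p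
          (volume.restrict (Ω : Set (RSpace n)))) atTop (𝓝 0) := by
  have key : ∀ (φ : ℕ → RSpace n → ℂ) (hφ : ∀ j, IsTestFun U (φ j)),
      Tendsto (fun j => ofSmooth n k p Ω ⟨(hφ j).1, (hφ j).2⟩) atTop (𝓝 f) ↔
      ∀ α : MultiIdx n k,
        Tendsto (fun j => eLpNorm (fun x => multiDeriv α.1 (φ j) x - weakDeriv α f x) p
          (volume.restrict (Ω : Set (RSpace n)))) atTop (𝓝 0) := by
    intro φ hφ
    rw [tendsto_iff]
    refine forall_congr' fun α => tendsto_congr fun j => eLpNorm_congr_ae ?_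
    filter_upwards [weakDeriv_ofSmooth_ae_eq (k := k) (p := p) (Ω := Ω) ⟨(hφ j).1, (hφ j).2⟩ α]
      with x hx
    rw [hx]
  rw [mem_closure_iff_seq_limit, testFunctions_eq]
  constructor
  · rintro ⟨u, hu, hlim⟩
    choose φ hφ hu using hu
    refine ⟨φ, hφ, (key φ hφ).1 ?_⟩
    exact hlim.congr hu
  · rintro ⟨φ, hφ, h⟩
    exact ⟨_, fun j => ⟨φ j, hφ j, rfl⟩, (key φ hφ).2 h⟩

end SobolevSpace

theorem tendsto_integral_mul_of_tendsto_eLpNorm {μ : Measure (RSpace n)}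
    [IsFiniteMeasureOnCompacts μ] {u : ℕ → RSpace n → ℂ} {f ψ : RSpace n → ℂ}
    (hu : ∀ j, MemLp (u j) p μ) (hf : MemLp f p μ)
    (h : Tendsto (fun j => eLpNorm (fun x => u j x - f x) p μ) atTop (𝓝 0))
    (hψ : ContDiff ℝ ∞ ψ ∧ HasCompactSupport ψ) :
    Tendsto (fun j => ∫ x, u j x * ψ x ∂μ) atTop (𝓝 (∫ x, f x * ψ x ∂μ)) := by
  have hq : ENNReal.HolderConjugate p (ENNReal.conjExponent p) :=
    ENNReal.HolderConjugate.conjExponent Fact.out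
  have hψm := memLp_of_smoothCompact hψ μ (ENNReal.conjExponent p)
  have hint : ∀ g, MemLp g p μ → Integrable (fun x => g x * ψ x) μ := by
    intro g hg
    rw [← memLp_one_iff_integrable]
    exact hψm.mul hg
  refine tendsto_integral_of_L1' _ (hint f hf).1 (.of_forall fun j => hint _ (hu j)) ?_
  refine tendsto_of_tendsto_of_tendsto_of_le_of_le tendsto_const_nhds
    (h := fun j => eLpNorm (fun x => u j x - f x) p μ *
      eLpNorm ψ (ENNReal.conjExponent p) μ) ?_ (fun _ => zero_le) ?_
  · have := ENNReal.Tendsto.mul_const h (Or.inr hψm.2.ne)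
    rwa [zero_mul] at this
  · intro j
    have h1 : (fun x => u j x * ψ x) - (fun x => f x * ψ x) = (u j - f) • ψ := by
      funext x
      simp [sub_mul]
    have h2 := eLpNorm_smul_le_mul_eLpNorm (p := p) (q := ENNReal.conjExponent p) (r := 1)
      hψm.1 ((hu j).1.sub hf.1)
    rw [← h1] at h2
    exact h2

/-- By Hölder both sides of the defining identity pass to the limit. The domain `Ω` may be larger
than the set supporting the approximants, which is what allows an extension across the origin. -/
theorem IsWeakDeriv.of_tendsto {α : Fin n → ℕ} {u v : ℕ → RSpace n → ℂ} {f g : RSpace n → ℂ}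
    (hu : ∀ j, MemLp (u j) p (volume.restrict (Ω : Set (RSpace n))))
    (hv : ∀ j, MemLp (v j) p (volume.restrict (Ω : Set (RSpace n))))
    (hf : MemLp f p (volume.restrict (Ω : Set (RSpace n))))
    (hg : MemLp g p (volume.restrict (Ω : Set (RSpace n))))
    (hw : ∀ j, IsWeakDeriv Ω α (u j) (v j))
    (huf : Tendsto (fun j => eLpNorm (fun x => u j x - f x) p
      (volume.restrict (Ω : Set (RSpace n)))) atTop (𝓝 0))
    (hvg : Tendsto (fun j => eLpNorm (fun x => v j x - g x) p
      (volume.restrict (Ω : Set (RSpace n)))) atTop (𝓝 0)) :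
    IsWeakDeriv Ω α f g := by
  intro φ hφ
  have h1 := tendsto_integral_mul_of_tendsto_eLpNorm hu hf huf
    (smoothCompact_multiDeriv α ⟨hφ.1, hφ.2⟩)
  have h2 := (tendsto_integral_mul_of_tendsto_eLpNorm hv hg hvg ⟨hφ.1, hφ.2⟩).const_mul
    ((-1 : ℂ) ^ (∑ i, α i))
  exact tendsto_nhds_unique h1 (h2.congr fun j => (hw j φ hφ).symm)

namespace SobolevSpace

/-- The multi-index `0`. -/
def zeroIdx (n k : ℕ) : MultiIdx n k := ⟨0, (mem_multiIdx_iff 0).mpr (by simp)⟩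

theorem weakDeriv_zeroIdx (f : SobolevSpace n k p Ω) : weakDeriv (zeroIdx n k) f = toLp f :=
  (isWeakDeriv (zeroIdx n k) f).unique fun φ _ => by simp [zeroIdx, multiDeriv_zero]

theorem restrict_top_eq :
    volume.restrict ((⊤ : Opens (RSpace n)) : Set (RSpace n)) = volume := by
  simp

theorem restrict_punctured_eq (hn : 1 ≤ n) :
    volume.restrict ((punctured n : Opens (RSpace n)) : Set (RSpace n)) = volume := by
  have : Nonempty (Fin n) := ⟨⟨0, hn⟩⟩
  refine Measure.restrict_eq_self_of_ae_mem ?_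
  have : (volume : Measure (RSpace n)) {0} = 0 := measure_singleton _
  filter_upwards [compl_mem_ae_iff.2 this] with x hx using hx

theorem ae_eq_restrict_top_iff {f g : RSpace n → ℂ} :
    f =ᵐ[volume.restrict ((⊤ : Opens (RSpace n)) : Set (RSpace n))] g ↔ f =ᵐ[volume] g := by
  rw [restrict_top_eq]

theorem eLpNorm_restrict_top {q : ℝ≥0∞} (g : RSpace n → ℂ) :
    eLpNorm g q (volume.restrict ((⊤ : Opens (RSpace n)) : Set (RSpace n))) =
      eLpNorm g q volume := by
  rw [restrict_top_eq]

theorem eLpNorm_restrict_punctured {q : ℝ≥0∞} (hn : 1 ≤ n) (g : RSpace n → ℂ) :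
    eLpNorm g q (volume.restrict ((punctured n : Opens (RSpace n)) : Set (RSpace n))) =
      eLpNorm g q volume := by
  rw [restrict_punctured_eq hn]

theorem weakDeriv_restriction_ae_eq {V : Opens (RSpace n)} (hV : V ≤ Ω)
    {f : SobolevSpace n k p Ω} {u : SobolevSpace n k p V}
    (h : f =ᵐ[volume.restrict (V : Set (RSpace n))] u) (α : MultiIdx n k) :
    weakDeriv α u =ᵐ[volume.restrict (V : Set (RSpace n))] weakDeriv α f := by
  have hV' : (V : Set (RSpace n)) ⊆ Ω := hV
  have hle : volume.restrict (V : Set (RSpace n)) ≤ volume.restrict (Ω : Set (RSpace n)) :=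
    Measure.restrict_mono hV' le_rfl
  refine weakDeriv_ae_eq ((Lp.memLp _).mono_measure hle) ?_
  refine IsWeakDeriv.congr_ae (u := f) (v := weakDeriv α f) ?_ h (ae_eq_refl _)
  intro φ hφ
  have e : ∀ (u ψ : RSpace n → ℂ), IsTestFun V ψ →
      ∫ x in V, u x * ψ x = ∫ x in Ω, u x * ψ x := by
    intro u ψ hψ
    refine (setIntegral_eq_of_subset_of_forall_sdiff_eq_zero Ω.isOpen.measurableSet hV'
      fun x hx => ?_).symm
    rw [image_eq_zero_of_notMem_tsupport fun hc => hx.2 (hψ.3 hc), mul_zero]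
  rw [e _ _ (hφ.multiDeriv α.1), e _ _ hφ]
  exact isWeakDeriv α f φ (hφ.mono hV)

/-- `W₀^{k,p}(ℝⁿ ∖ {0})` is the restriction of the closure of `C₀^∞(ℝⁿ ∖ {0})` in
`W^{k,p}(ℝⁿ)`. -/
theorem sobolevZero_punctured (hn : 1 ≤ n) :
    sobolevZero k p (punctured n) =
      restrictions (punctured n) (closure (testFunctions k p (punctured n) ⊤)) := by
  have hPe := eLpNorm_restrict_punctured hn (q := p)
  have hTe := eLpNorm_restrict_top (n := n) (q := p)
  have hae : ∀ f g : RSpace n → ℂ,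
      f =ᵐ[volume.restrict ((punctured n : Opens (RSpace n)) : Set (RSpace n))] g ↔
        f =ᵐ[volume.restrict ((⊤ : Opens (RSpace n)) : Set (RSpace n))] g := by
    intro f g
    rw [restrict_punctured_eq hn, restrict_top_eq]
  ext u
  simp only [sobolevZero, restrictions, mem_ofPred_eq]
  constructor
  · intro hu
    obtain ⟨φ, hφ, hlim⟩ := mem_closure_testFunctions_iff.1 hu
    simp only [hPe] at hlim
    have hm : ∀ g : Lp ℂ p (volume.restrict ((punctured n : Opens (RSpace n)) : Set (RSpace n))),
        MemLp g p (volume.restrict ((⊤ : Opens (RSpace n)) : Set (RSpace n))) := by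
      intro g
      have h1 : volume.restrict ((⊤ : Opens (RSpace n)) : Set (RSpace n)) =
          volume.restrict ((punctured n : Opens (RSpace n)) : Set (RSpace n)) := by
        rw [restrict_punctured_eq hn, restrict_top_eq]
      exact (Lp.memLp g).mono_measure h1.le
    have hs : ∀ j, ContDiff ℝ ∞ (φ j) ∧ HasCompactSupport (φ j) := fun j => ⟨(hφ j).1, (hφ j).2⟩
    have hlim0 := hlim (zeroIdx n k)
    simp only [weakDeriv_zeroIdx] at hlim0
    simp only [zeroIdx, multiDeriv_zero] at hlim0
    -- A general element of `W^{k,p}(ℝⁿ ∖ {0})` need not have weak derivatives on `ℝⁿ` (a jump at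
    -- `0` for `n = 1`). Here the approximants `φ j` are smooth on `ℝⁿ`, and their identities
    -- against test functions not vanishing near `0` survive the limit.
    obtain ⟨f, hf, hfα⟩ := exists_of_memLp (n := n) (k := k) (p := p) (Ω := ⊤) (f := toLp u)
      (g := fun α => weakDeriv α u) (hm _) (fun α => hm _) (fun α =>
        IsWeakDeriv.of_tendsto (u := φ) (v := fun j => multiDeriv α.1 (φ j))
          (fun j => memLp_of_smoothCompact (hs j) _ p)
          (fun j => memLp_of_smoothCompact (smoothCompact_multiDeriv α.1 (hs j)) _ p)
          (hm _) (hm _) (fun j => IsWeakDeriv.of_contDiff (hs j).1 α.1)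
          (by simpa only [hTe] using hlim0) (by simpa only [hTe] using hlim α))
    refine ⟨f, mem_closure_testFunctions_iff.2 ⟨φ, hφ, fun α => ?_⟩, (hae _ _).2 hf⟩
    simp only [← hTe] at hlim
    refine (hlim α).congr fun j => eLpNorm_congr_ae ?_
    filter_upwards [hfα α] with x hx
    rw [hx]
  · rintro ⟨f, hf, hfu⟩
    obtain ⟨φ, hφ, hlim⟩ := mem_closure_testFunctions_iff.1 hf
    refine mem_closure_testFunctions_iff.2 ⟨φ, hφ, fun α => ?_⟩
    simp only [hTe] at hlim
    simp only [← hPe] at hlim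
    refine (hlim α).congr fun j => eLpNorm_congr_ae ?_
    filter_upwards [weakDeriv_restriction_ae_eq (le_top : punctured n ≤ ⊤) hfu α] with x hx
    rw [hx]

end SobolevSpace

end SobolevInterface

/-! ### Mollification in `L^p` -/

section Mollification

open Filter Topology
open scoped Convolution

variable {n : ℕ}

/-- Jensen's inequality for the average of a family of functions, integrated. -/
theorem lintegral_lintegral_rpow_le {X Y : Type*} [MeasurableSpace X] [MeasurableSpace Y]
    {μ : Measure X} {ν : Measure Y} [SFinite μ] [SFinite ν] {κ : Y → ℝ≥0∞} (hκ : Measurable κ)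
    {H : X → Y → ℝ≥0∞} (hH : Measurable (Function.uncurry H)) {q : ℝ} (hq : 1 ≤ q) :
    ∫⁻ x, (∫⁻ y, κ y * H x y ∂ν) ^ q ∂μ ≤
      (∫⁻ y, κ y ∂ν) ^ (q - 1) * ∫⁻ y, κ y * ∫⁻ x, H x y ^ q ∂μ ∂ν := by
  have hq0 : 0 < q := zero_lt_one.trans_le hq
  have h1 : ∀ x, (∫⁻ y, κ y * H x y ∂ν) ^ q ≤
      (∫⁻ y, κ y ∂ν) ^ (q - 1) * ∫⁻ y, κ y * H x y ^ q ∂ν := by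
    intro x
    have hHx : Measurable (H x) := hH.of_uncurry_left
    -- The `L¹` and `L^q` norms of `H x` are compared for the measure `κ ν`, whose total mass gives
    -- the factor `(∫ κ)^{q-1}` after raising to the power `q`.
    have h := eLpNorm'_le_eLpNorm'_mul_rpow_measure_univ (μ := ν.withDensity κ) (f := H x)
      one_pos hq hHx.aestronglyMeasurable
    simp only [eLpNorm'_eq_lintegral_enorm, enorm_eq_self, ENNReal.rpow_one, div_one] at h
    rw [lintegral_withDensity_eq_lintegral_mul _ hκ hHx,
      lintegral_withDensity_eq_lintegral_mul _ hκ (hHx.pow_const q),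
      withDensity_apply _ MeasurableSet.univ, Measure.restrict_univ] at h
    have h' := ENNReal.rpow_le_rpow h hq0.le
    rw [ENNReal.mul_rpow_of_nonneg _ _ hq0.le, ← ENNReal.rpow_mul, ← ENNReal.rpow_mul,
      one_div_mul_cancel hq0.ne', ENNReal.rpow_one, sub_mul, one_div_mul_cancel hq0.ne',
      one_mul] at h'
    exact h'.trans_eq (mul_comm _ _)
  refine (lintegral_mono h1).trans ?_
  rw [lintegral_const_mul _ (Measurable.lintegral_prod_right'
    (f := fun z : X × Y => κ z.2 * H z.1 z.2 ^ q)
    ((hκ.comp measurable_snd).mul (hH.pow_const q)))]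
  gcongr
  rw [lintegral_lintegral_swap (f := fun x y => κ y * H x y ^ q)
    ((hκ.comp measurable_snd).mul (hH.pow_const q)).aemeasurable]
  refine le_of_eq (lintegral_congr fun y => ?_)
  exact lintegral_const_mul _ (hH.of_uncurry_right.pow_const q)

theorem eLpNorm_rpow_toReal {X F : Type*} [MeasurableSpace X] {μ : Measure X}
    [NormedAddCommGroup F] {p : ℝ≥0∞} (hp1 : 1 ≤ p) (hp : p ≠ ⊤) (f : X → F) :
    eLpNorm f p μ ^ p.toReal = ∫⁻ x, ‖f x‖ₑ ^ p.toReal ∂μ := by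
  have h0 : p ≠ 0 := (zero_lt_one.trans_le hp1).ne'
  have : 0 < p.toReal := ENNReal.toReal_pos h0 hp
  rw [eLpNorm_eq_lintegral_rpow_enorm_toReal h0 hp, ← ENNReal.rpow_mul,
    one_div_mul_cancel this.ne', ENNReal.rpow_one]

theorem one_le_toReal_of_one_le {p : ℝ≥0∞} (hp1 : 1 ≤ p) (hp : p ≠ ⊤) : 1 ≤ p.toReal := by
  simpa using (ENNReal.toReal_le_toReal ENNReal.one_ne_top hp).2 hp1

/-- Young's inequality `‖ψ ⋆ g‖_p ≤ ‖ψ‖₁ ‖g‖_p`, in the form of a membership statement. -/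
theorem memLp_convolution {p : ℝ≥0∞} (hp1 : 1 ≤ p) (hp : p ≠ ⊤) {ψ g : RSpace n → ℂ}
    (hψ : ContDiff ℝ ∞ ψ ∧ HasCompactSupport ψ) (hgm : Measurable g) (hg : MemLp g p volume) :
    MemLp (ψ ⋆[ContinuousLinearMap.mul ℝ ℂ, volume] g) p volume := by
  have hq := one_le_toReal_of_one_le hp1 hp
  have hq0 : 0 < p.toReal := zero_lt_one.trans_le hq
  have hloc : LocallyIntegrable g volume := hg.locallyIntegrable hp1
  have hcont : Continuous (ψ ⋆[ContinuousLinearMap.mul ℝ ℂ, volume] g) :=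
    (hψ.2.contDiff_convolution_left (n := 1) _ (hψ.1.of_le (by exact_mod_cast le_top))
      hloc).continuous
  refine ⟨hcont.aestronglyMeasurable, ?_⟩
  have hle : ∀ x, ‖(ψ ⋆[ContinuousLinearMap.mul ℝ ℂ, volume] g) x‖ₑ ≤
      ∫⁻ y, ‖ψ y‖ₑ * ‖g (x - y)‖ₑ := by
    intro x
    refine (enorm_integral_le_lintegral_enorm _).trans (le_of_eq ?_)
    refine lintegral_congr fun y => ?_
    rw [ContinuousLinearMap.mul_apply', enorm_mul]
  have h2 := lintegral_lintegral_rpow_le (μ := (volume : Measure (RSpace n)))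
    (ν := (volume : Measure (RSpace n))) (κ := fun y => ‖ψ y‖ₑ)
    hψ.1.continuous.measurable.enorm (H := fun x y => ‖g (x - y)‖ₑ)
    (hgm.comp (measurable_fst.sub measurable_snd)).enorm hq
  have h3 : ∀ y, ∫⁻ x, ‖g (x - y)‖ₑ ^ p.toReal = ∫⁻ x, ‖g x‖ₑ ^ p.toReal := fun y =>
    lintegral_sub_right_eq_self (fun x => ‖g x‖ₑ ^ p.toReal) y
  simp only [h3] at h2
  have hψ1 : ∫⁻ y, ‖ψ y‖ₑ < ⊤ :=
    (hψ.1.continuous.integrable_of_hasCompactSupport hψ.2).hasFiniteIntegral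
  have hg1 : ∫⁻ x, ‖g x‖ₑ ^ p.toReal < ⊤ := by
    rw [← eLpNorm_rpow_toReal hp1 hp]
    exact ENNReal.rpow_lt_top_of_nonneg hq0.le hg.2.ne
  rw [lintegral_mul_const _ hψ.1.continuous.measurable.enorm] at h2
  have h4 : eLpNorm (ψ ⋆[ContinuousLinearMap.mul ℝ ℂ, volume] g) p volume ^ p.toReal < ⊤ := by
    rw [eLpNorm_rpow_toReal hp1 hp]
    refine (lintegral_mono fun x => ENNReal.rpow_le_rpow (hle x) hq0.le).trans_lt
      (h2.trans_lt ?_)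
    exact ENNReal.mul_lt_top (ENNReal.rpow_lt_top_of_nonneg (by linarith) hψ1.ne)
      (ENNReal.mul_lt_top hψ1 hg1)
  by_contra hc
  rw [not_lt, top_le_iff] at hc
  rw [hc, ENNReal.top_rpow_of_pos hq0] at h4
  exact lt_irrefl _ h4

/-- Translations are continuous in `L^p`. -/
theorem tendsto_eLpNorm_translate_sub {p : ℝ≥0∞} (hp1 : 1 ≤ p) (hp : p ≠ ⊤) {g : RSpace n → ℂ}
    (hg : MemLp g p volume) :
    Tendsto (fun y => eLpNorm (fun x => g (x - y) - g x) p volume) (𝓝 0) (𝓝 0) := by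
  have : Fact (1 ≤ p) := ⟨hp1⟩
  let T : RSpace n → C(RSpace n, RSpace n) := fun y => ⟨fun x => x - y, by fun_prop⟩
  have hT : Continuous T :=
    (ContinuousMap.curry ⟨fun z : RSpace n × RSpace n => z.2 - z.1, by fun_prop⟩).continuous
  have hmp : ∀ y, MeasurePreserving (T y) volume volume := fun y =>
    measurePreserving_sub_right volume y
  have h := (continuous_const (y := hg.toLp g)).compMeasurePreservingLp hT hmp hp
  have h0 := h.tendsto 0
  rw [Lp.tendsto_Lp_iff_tendsto_eLpNorm'] at h0
  refine h0.congr fun y => eLpNorm_congr_ae ?_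
  have e : ∀ y, Lp.compMeasurePreserving (T y) (hmp y) (hg.toLp g) =ᵐ[volume]
      fun x => g (x - y) := fun y =>
    (Lp.coeFn_compMeasurePreserving _ _).trans
      ((hmp y).quasiMeasurePreserving.ae_eq_comp hg.coeFn_toLp)
  filter_upwards [e y, e 0] with x h1 h2
  simp only [Pi.sub_apply]
  rw [h1, h2, sub_zero]

/-- The complex-valued mollifier attached to a bump function. -/
def mollifier (ρ : ContDiffBump (0 : RSpace n)) : RSpace n → ℂ := fun x => (ρ.normed volume x : ℂ)

theorem mollifier_smoothCompact (ρ : ContDiffBump (0 : RSpace n)) :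
    ContDiff ℝ ∞ (mollifier ρ) ∧ HasCompactSupport (mollifier ρ) :=
  ⟨Complex.ofRealCLM.contDiff.comp ρ.contDiff_normed,
    ρ.hasCompactSupport_normed.comp_left Complex.ofReal_zero⟩

/-- The difference is an average, of total mass `1`, of the functions `g(· - y) - g` with `|y| <
ρ.rOut`; Jensen reduces it to the continuity of translations. The bound is uniform in `ρ`, so that
one bump function can serve all multi-indices at once. -/
theorem eventually_eLpNorm_mollifier_sub_le {p : ℝ≥0∞} (hp1 : 1 ≤ p) (hp : p ≠ ⊤)
    {g : RSpace n → ℂ} (hgm : Measurable g) (hg : MemLp g p volume) {ε : ℝ≥0∞} (hε : ε ≠ 0) :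
    ∀ᶠ δ in 𝓝[>] (0 : ℝ), ∀ ρ : ContDiffBump (0 : RSpace n), ρ.rOut ≤ δ →
      eLpNorm (fun x => (mollifier ρ ⋆[ContinuousLinearMap.mul ℝ ℂ, volume] g) x - g x) p volume
        ≤ ε := by
  have hq := one_le_toReal_of_one_le hp1 hp
  have hq0 : 0 < p.toReal := zero_lt_one.trans_le hq
  have hev : ∀ᶠ y in 𝓝 (0 : RSpace n), eLpNorm (fun x => g (x - y) - g x) p volume ≤ ε :=
    (tendsto_eLpNorm_translate_sub hp1 hp hg).eventually_le_const (pos_iff_ne_zero.2 hε)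
  obtain ⟨δ, hδ, hball⟩ := Metric.eventually_nhds_iff.1 hev
  filter_upwards [Ioo_mem_nhdsGT hδ] with δ' hδ' ρ hρ
  have hψ := mollifier_smoothCompact ρ
  have hloc : LocallyIntegrable g volume := hg.locallyIntegrable hp1
  have hint1 : ∫ y, mollifier ρ y = 1 := by
    unfold mollifier
    rw [integral_complex_ofReal, ρ.integral_normed, Complex.ofReal_one]
  have hle : ∀ x, ‖(mollifier ρ ⋆[ContinuousLinearMap.mul ℝ ℂ, volume] g) x - g x‖ₑ ≤
      ∫⁻ y, ‖mollifier ρ y‖ₑ * ‖g (x - y) - g x‖ₑ := by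
    intro x
    have hex := hψ.2.convolutionExists_left (ContinuousLinearMap.mul ℝ ℂ) hψ.1.continuous hloc x
    have hI : Integrable (fun y => mollifier ρ y * g x) volume :=
      (hψ.1.continuous.integrable_of_hasCompactSupport hψ.2).mul_const _
    have : (mollifier ρ ⋆[ContinuousLinearMap.mul ℝ ℂ, volume] g) x - g x =
        ∫ y, mollifier ρ y * (g (x - y) - g x) := by
      have h1 : g x = ∫ y, mollifier ρ y * g x := by
        rw [integral_mul_const, hint1, one_mul]
      conv_lhs => rw [h1]
      rw [convolution_def, ← integral_sub hex hI]
      refine integral_congr_ae (.of_forall fun y => ?_)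
      simp only [ContinuousLinearMap.mul_apply']
      ring
    rw [this]
    refine (enorm_integral_le_lintegral_enorm _).trans (le_of_eq ?_)
    exact lintegral_congr fun y => enorm_mul _ _
  have hκ : ∫⁻ y, ‖mollifier ρ y‖ₑ = 1 := by
    have : ∀ y, ‖mollifier ρ y‖ₑ = ENNReal.ofReal (ρ.normed volume y) := by
      intro y
      rw [← ofReal_norm, mollifier, Complex.norm_real, Real.norm_of_nonneg
        (ρ.nonneg_normed y)]
    simp only [this]
    rw [← ofReal_integral_eq_lintegral_ofReal ρ.integrable_normed
      (.of_forall ρ.nonneg_normed), ρ.integral_normed, ENNReal.ofReal_one]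
  have h2 := lintegral_lintegral_rpow_le (μ := (volume : Measure (RSpace n)))
    (ν := (volume : Measure (RSpace n))) (κ := fun y => ‖mollifier ρ y‖ₑ)
    hψ.1.continuous.measurable.enorm (H := fun x y => ‖g (x - y) - g x‖ₑ)
    ((hgm.comp (measurable_fst.sub measurable_snd)).sub (hgm.comp measurable_fst)).enorm hq
  have h3 : ∫⁻ y, ‖mollifier ρ y‖ₑ * ∫⁻ x, ‖g (x - y) - g x‖ₑ ^ p.toReal ≤ ε ^ p.toReal := by
    calc ∫⁻ y, ‖mollifier ρ y‖ₑ * ∫⁻ x, ‖g (x - y) - g x‖ₑ ^ p.toReal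
        ≤ ∫⁻ y, ‖mollifier ρ y‖ₑ * ε ^ p.toReal := by
          refine lintegral_mono fun y => ?_
          by_cases hy : mollifier ρ y = 0
          · simp [hy]
          · gcongr
            rw [← eLpNorm_rpow_toReal hp1 hp]
            gcongr
            refine hball ?_
            have : y ∈ Function.support (ρ.normed volume) := by
              intro hc
              exact hy (by simp [mollifier, hc])
            rw [ρ.support_normed_eq, Metric.mem_ball] at this
            exact this.trans_le (hρ.trans hδ'.2.le)
      _ = ε ^ p.toReal := by
          rw [lintegral_mul_const _ hψ.1.continuous.measurable.enorm, hκ, one_mul]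
  rw [hκ, ENNReal.one_rpow, one_mul] at h2
  rw [← ENNReal.rpow_le_rpow_iff hq0, eLpNorm_rpow_toReal hp1 hp]
  exact (lintegral_mono fun x => ENNReal.rpow_le_rpow (hle x) hq0.le).trans (h2.trans h3)

theorem contDiff_convolution {ψ g : RSpace n → ℂ}
    (hψ : ContDiff ℝ ∞ ψ ∧ HasCompactSupport ψ) (hg : LocallyIntegrable g volume) :
    ContDiff ℝ ∞ (ψ ⋆[ContinuousLinearMap.mul ℝ ℂ, volume] g) :=
  hψ.2.contDiff_convolution_left (n := ⊤) _ hψ.1 hg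

theorem partialDeriv_convolution {ψ g : RSpace n → ℂ}
    (hψ : ContDiff ℝ ∞ ψ ∧ HasCompactSupport ψ) (hg : LocallyIntegrable g volume) (i : Fin n) :
    partialDeriv i (ψ ⋆[ContinuousLinearMap.mul ℝ ℂ, volume] g) =
      partialDeriv i ψ ⋆[ContinuousLinearMap.mul ℝ ℂ, volume] g := by
  funext x
  have h1 : ContDiff ℝ 1 ψ := hψ.1.of_le (by exact_mod_cast le_top)
  have h := hψ.2.hasFDerivAt_convolution_left (ContinuousLinearMap.mul ℝ ℂ) h1 hg x
  rw [partialDeriv, h.fderiv, convolution_def, convolution_def]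
  have hex := (hψ.2.fderiv ℝ).convolutionExists_left
    ((ContinuousLinearMap.mul ℝ ℂ).precompL (RSpace n)) (h1.continuous_fderiv (by simp)) hg x
  rw [ContinuousLinearMap.integral_apply hex]
  rfl

theorem multiDeriv_convolution {ψ g : RSpace n → ℂ}
    (hψ : ContDiff ℝ ∞ ψ ∧ HasCompactSupport ψ) (hg : LocallyIntegrable g volume)
    (α : Fin n → ℕ) :
    multiDeriv α (ψ ⋆[ContinuousLinearMap.mul ℝ ℂ, volume] g) =
      multiDeriv α ψ ⋆[ContinuousLinearMap.mul ℝ ℂ, volume] g := by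
  have := multiDeriv_family_induction (ι := Bool)
    (R := fun _ Ψ => (ContDiff ℝ ∞ (Ψ false) ∧ HasCompactSupport (Ψ false)) ∧
      Ψ true = Ψ false ⋆[ContinuousLinearMap.mul ℝ ℂ, volume] g)
    (Φ := fun b => if b then ψ ⋆[ContinuousLinearMap.mul ℝ ℂ, volume] g else ψ)
    ⟨by simpa using hψ, by simp⟩
    (fun j _ Ψ hΨ => ⟨smoothCompact_partialDeriv j hΨ.1, by
      simp only [hΨ.2, partialDeriv_convolution hΨ.1 hg]⟩) α
  simpa using this.2

/-- Mollification commutes with weak derivatives. -/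
theorem multiDeriv_convolution_of_isWeakDeriv {ψ f g : RSpace n → ℂ}
    (hψ : ContDiff ℝ ∞ ψ ∧ HasCompactSupport ψ) (hf : LocallyIntegrable f volume)
    {α : Fin n → ℕ} (h : IsWeakDeriv ⊤ α f g) :
    multiDeriv α (ψ ⋆[ContinuousLinearMap.mul ℝ ℂ, volume] f) =
      ψ ⋆[ContinuousLinearMap.mul ℝ ℂ, volume] g := by
  rw [multiDeriv_convolution hψ hf]
  funext x
  have hflip : ∀ ψ f : RSpace n → ℂ, (ψ ⋆[ContinuousLinearMap.mul ℝ ℂ, volume] f) x =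
      ∫ y, f y * ψ (x - y) := by
    intro ψ f
    rw [convolution_eq_swap]
    refine integral_congr_ae (.of_forall fun y => ?_)
    simp [mul_comm]
  -- The weak derivative is tested against `y ↦ ψ (x - y)`; the reflection contributes a second sign
  -- `(-1)^|α|`, which cancels that of the definition.
  have ht : IsTestFun (⊤ : Opens (RSpace n)) (fun y => ψ (x - y)) :=
    isTestFun_top.2 ⟨hψ.1.comp (contDiff_const.sub contDiff_id),
      hψ.2.comp_homeomorph (Homeomorph.subLeft x)⟩
  have := h _ ht
  simp only [Opens.coe_top, Measure.restrict_univ, multiDeriv_comp_const_sub hψ.1] at this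
  rw [hflip, hflip]
  have h2 : ∀ y, f y * ((-1) ^ (∑ i, α i) * multiDeriv α ψ (x - y)) =
      (-1) ^ (∑ i, α i) * (f y * multiDeriv α ψ (x - y)) := fun y => by ring
  simp only [h2] at this
  rw [integral_const_mul] at this
  exact mul_left_cancel₀ (pow_ne_zero _ (neg_ne_zero.mpr one_ne_zero)) this

/-- The total derivative is the sum of the `D_i u` tensored with the coordinate functionals, and
these have norm at most `1`. -/
theorem norm_iteratedFDeriv_succ_le_sum {u : RSpace n → ℂ} (hu : ContDiff ℝ ∞ u) (l : ℕ)
    (x : RSpace n) : ‖iteratedFDeriv ℝ (l + 1) u x‖ ≤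
      ∑ i, ‖iteratedFDeriv ℝ l (partialDeriv i u) x‖ := by
  let T : Fin n → ℂ →L[ℝ] RSpace n →L[ℝ] ℂ := fun i =>
    ContinuousLinearMap.smulRightL ℝ (RSpace n) ℂ (EuclideanSpace.proj i)
  have hT : ∀ i, ‖T i‖ ≤ 1 := by
    intro i
    rw [ContinuousLinearMap.norm_smulRightL]
    refine ContinuousLinearMap.opNorm_le_bound _ zero_le_one fun v => ?_
    rw [one_mul]
    exact PiLp.norm_apply_le v i
  have e : fderiv ℝ u = fun y => ∑ i, (T i ∘ partialDeriv i u) y := by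
    funext y
    ext v
    conv_lhs => rw [← (EuclideanSpace.basisFun (Fin n) ℝ).sum_repr v]
    simp [T, partialDeriv, sum_apply]
  rw [← norm_iteratedFDeriv_fderiv, e, iteratedFDeriv_fun_sum_apply fun i _ =>
    ((T i).contDiff.comp ((hu.partialDeriv i).of_le (by exact_mod_cast le_top))).contDiffAt]
  refine (norm_sum_le _ _).trans (Finset.sum_le_sum fun i _ => ?_)
  refine ((T i).norm_iteratedFDeriv_comp_left (hu.partialDeriv i).contDiffAt
    (by exact_mod_cast le_top)).trans ?_
  exact mul_le_of_le_one_left (norm_nonneg _) (hT i)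

/-- Every derivative can be put on `ψ`, so all orders are in `L^p` although `g` has no regularity.
This supplies the integrability needed for truncation. -/
theorem memLp_norm_iteratedFDeriv_convolution {p : ℝ≥0∞} (hp1 : 1 ≤ p) (hp : p ≠ ⊤)
    {g : RSpace n → ℂ} (hgm : Measurable g) (hg : MemLp g p volume) (l : ℕ) :
    ∀ {ψ : RSpace n → ℂ}, ContDiff ℝ ∞ ψ ∧ HasCompactSupport ψ →
      MemLp (fun x => ‖iteratedFDeriv ℝ l
        (ψ ⋆[ContinuousLinearMap.mul ℝ ℂ, volume] g) x‖) p volume := by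
  have hloc : LocallyIntegrable g volume := hg.locallyIntegrable hp1
  induction l with
  | zero =>
    intro ψ hψ
    simpa using (memLp_convolution hp1 hp hψ hgm hg).norm
  | succ l ih =>
    intro ψ hψ
    have hs : MemLp (fun x => ∑ i, ‖iteratedFDeriv ℝ l (partialDeriv i
        (ψ ⋆[ContinuousLinearMap.mul ℝ ℂ, volume] g)) x‖) p volume := by
      refine memLp_finsetSum _ fun i _ => ?_
      rw [partialDeriv_convolution hψ hloc]
      exact ih (smoothCompact_partialDeriv i hψ)
    have hc := contDiff_convolution hψ hloc
    refine hs.mono' ?_ (.of_forall fun x => ?_)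
    · exact (hc.continuous_iteratedFDeriv
        (by exact_mod_cast le_top)).norm.aestronglyMeasurable
    · rw [norm_norm]
      exact norm_iteratedFDeriv_succ_le_sum hc l x

end Mollification

/-! ### Density of test functions in `W^{k,p}(ℝⁿ)` -/

section Density

open Filter Topology
open scoped Convolution

variable {n : ℕ}

theorem tendsto_eLpNorm_of_dominated {X : Type*} [MeasurableSpace X] {μ : Measure X}
    {p : ℝ≥0∞} (hp1 : 1 ≤ p) (hp : p ≠ ⊤) {u : ℕ → X → ℂ} {h : X → ℝ}
    (hu : ∀ j, AEStronglyMeasurable (u j) μ) (hh : MemLp h p μ) (hle : ∀ j x, ‖u j x‖ ≤ h x)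
    (hlim : ∀ x, Tendsto (fun j => u j x) atTop (𝓝 0)) :
    Tendsto (fun j => eLpNorm (u j) p μ) atTop (𝓝 0) := by
  have hq := one_le_toReal_of_one_le hp1 hp
  have hq0 : 0 < p.toReal := zero_lt_one.trans_le hq
  have h0 : p ≠ 0 := (zero_lt_one.trans_le hp1).ne'
  have hL : Tendsto (fun j => ∫⁻ x, ‖u j x‖ₑ ^ p.toReal ∂μ) atTop (𝓝 (∫⁻ _, 0 ∂μ)) := by
    refine tendsto_lintegral_of_dominated_convergence' (fun x => ‖h x‖ₑ ^ p.toReal)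
      (fun j => (hu j).enorm.pow_const _) (fun j => .of_forall fun x => ?_) ?_
      (.of_forall fun x => ?_)
    · refine ENNReal.rpow_le_rpow (enorm_le_iff_norm_le.2 ?_) hq0.le
      exact (hle j x).trans (le_abs_self _)
    · rw [← eLpNorm_rpow_toReal hp1 hp]
      exact (ENNReal.rpow_lt_top_of_nonneg hq0.le hh.2.ne).ne
    · have h1 : Tendsto (fun j => ‖u j x‖ₑ) atTop (𝓝 0) := by
        simpa using (hlim x).enorm
      have h3 := h1.ennrpow_const p.toReal
      rwa [ENNReal.zero_rpow_of_pos hq0] at h3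
  have h2 := (ENNReal.continuous_rpow_const (y := 1 / p.toReal)).continuousAt.tendsto.comp hL
  simp only [lintegral_zero, ENNReal.zero_rpow_of_pos (one_div_pos.2 hq0)] at h2
  refine h2.congr fun j => ?_
  rw [eLpNorm_eq_lintegral_rpow_enorm_toReal h0 hp]
  rfl

theorem exists_bound_iteratedFDeriv {φ : RSpace n → ℂ}
    (hφ : ContDiff ℝ ∞ φ ∧ HasCompactSupport φ) (N : ℕ) :
    ∃ C : ℝ, 0 ≤ C ∧ ∀ i ≤ N, ∀ x, ‖iteratedFDeriv ℝ i φ x‖ ≤ C := by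
  have h : ∀ i, ∃ C, ∀ x, ‖iteratedFDeriv ℝ i φ x‖ ≤ C := fun i =>
    (hφ.1.continuous_iteratedFDeriv (by exact_mod_cast le_top)).bounded_above_of_compact_support
      (hφ.2.iteratedFDeriv i)
  choose C hC using h
  have h0 : ∀ i, 0 ≤ C i := fun i => (norm_nonneg _).trans (hC i 0)
  refine ⟨∑ i ∈ Finset.range (N + 1), C i, Finset.sum_nonneg fun i _ => h0 i, fun i hi x => ?_⟩
  exact (hC i x).trans (Finset.single_le_sum (f := C) (fun i _ => h0 i)
    (Finset.mem_range.2 (by omega)))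

theorem norm_iteratedFDeriv_comp_smul {φ : RSpace n → ℂ} (hφ : ContDiff ℝ ∞ φ) (a : ℝ) (i : ℕ)
    (x : RSpace n) :
    ‖iteratedFDeriv ℝ i (fun x => φ (a • x)) x‖ = |a| ^ i * ‖iteratedFDeriv ℝ i φ (a • x)‖ := by
  rw [iteratedFDeriv_comp_const_smul a (hφ.of_le (by exact_mod_cast le_top)), norm_smul, norm_pow,
    Real.norm_eq_abs]

/-- A smooth function equal to `1` on the closed unit ball and supported in the closed ball of
radius `3 / 2`. -/
theorem exists_cutoff (n : ℕ) : ∃ χ : RSpace n → ℂ, (ContDiff ℝ ∞ χ ∧ HasCompactSupport χ) ∧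
    (∀ x, ‖x‖ ≤ 1 → χ x = 1) ∧ tsupport χ ⊆ Metric.closedBall 0 (3 / 2) := by
  let b : ContDiffBump (0 : RSpace n) := ⟨1, 3 / 2, by norm_num, by norm_num⟩
  refine ⟨fun x => (b x : ℂ), ⟨Complex.ofRealCLM.contDiff.comp b.contDiff,
    b.hasCompactSupport.comp_left Complex.ofReal_zero⟩, fun x hx => ?_, ?_⟩
  · have : b x = 1 := b.one_of_mem_closedBall (by simpa [b] using hx)
    simp [this]
  · refine (closure_mono (Function.support_comp_subset Complex.ofReal_zero b)).trans ?_
    rw [← tsupport, b.tsupport_eq]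

theorem norm_multiDeriv_mul_le {χ u : RSpace n → ℂ} (hχ : ContDiff ℝ ∞ χ) (hu : ContDiff ℝ ∞ u)
    (α : Fin n → ℕ) (x : RSpace n) :
    ‖multiDeriv α (fun x => χ x * u x) x‖ ≤ ∑ i ∈ Finset.range (∑ j, α j + 1),
      ((∑ j, α j).choose i : ℝ) * ‖iteratedFDeriv ℝ i χ x‖ *
        ‖iteratedFDeriv ℝ (∑ j, α j - i) u x‖ :=
  (norm_multiDeriv_le (hχ.mul hu) α x).trans
    (norm_iteratedFDeriv_mul_le hχ hu x (by exact_mod_cast le_top))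

/-- Truncation: a smooth function all of whose derivatives are in `L^p` is approximated by its
products with cutoffs. -/
theorem tendsto_eLpNorm_multiDeriv_cutoff {p : ℝ≥0∞} (hp1 : 1 ≤ p) (hp : p ≠ ⊤)
    {χ u : RSpace n → ℂ} (hχ : ContDiff ℝ ∞ χ ∧ HasCompactSupport χ) (hχ1 : ∀ x, ‖x‖ ≤ 1 → χ x = 1)
    (hu : ContDiff ℝ ∞ u) (hup : ∀ l, MemLp (fun x => ‖iteratedFDeriv ℝ l u x‖) p volume)
    (α : Fin n → ℕ) :
    Tendsto (fun j : ℕ => eLpNorm (fun x => multiDeriv α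
      (fun x => χ ((1 / ((j : ℝ) + 1)) • x) * u x) x - multiDeriv α u x) p volume)
      atTop (𝓝 0) := by
  obtain ⟨C, hC0, hC⟩ := exists_bound_iteratedFDeriv hχ (∑ j, α j)
  set N := ∑ j, α j with hN
  have hχs : ∀ a : ℝ, ContDiff ℝ ∞ (fun x => χ (a • x)) := fun a =>
    hχ.1.comp (contDiff_const_smul a)
  -- Leibniz majorant, independent of `j`: the dilation factors `(1/(j+1))^i` are at most `1`.
  have hh : MemLp (fun x => (∑ i ∈ Finset.range (N + 1),
      ((N.choose i : ℝ) * C) * ‖iteratedFDeriv ℝ (N - i) u x‖) + ‖iteratedFDeriv ℝ N u x‖)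
      p volume :=
    (memLp_finsetSum _ fun i _ => (hup (N - i)).const_mul ((N.choose i : ℝ) * C)).add (hup N)
  refine tendsto_eLpNorm_of_dominated hp1 hp (fun j => ?_) hh (fun j x => ?_) (fun x => ?_)
  · exact (((hχs _).mul hu).multiDeriv α).continuous.aestronglyMeasurable.sub
      (hu.multiDeriv α).continuous.aestronglyMeasurable
  · refine (norm_sub_le _ _).trans (add_le_add ?_ (norm_multiDeriv_le hu α x))
    refine (norm_multiDeriv_mul_le (hχs _) hu α x).trans (Finset.sum_le_sum fun i hi => ?_)
    gcongr
    rw [norm_iteratedFDeriv_comp_smul hχ.1]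
    have h1 : |1 / ((j : ℝ) + 1)| ≤ 1 := by
      rw [abs_of_nonneg (by positivity), div_le_one (by positivity)]
      linarith [(Nat.cast_nonneg j : (0 : ℝ) ≤ j)]
    calc |1 / ((j : ℝ) + 1)| ^ i * ‖iteratedFDeriv ℝ i χ ((1 / ((j : ℝ) + 1)) • x)‖
        ≤ 1 * C := by
          gcongr
          · exact pow_le_one₀ (abs_nonneg _) h1
          · exact hC i (by have := Finset.mem_range.1 hi; omega) _
      _ = C := one_mul C
  · refine tendsto_const_nhds.congr' ?_
    -- For such `j` the cutoff equals `1` on an open ball containing `x`, so the difference is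
    -- exactly zero there.
    filter_upwards [eventually_gt_atTop ⌈‖x‖⌉₊] with j hj
    have hj' : ‖x‖ < j := (Nat.le_ceil _).trans_lt (by exact_mod_cast hj)
    have : EqOn (fun x => χ ((1 / ((j : ℝ) + 1)) • x) * u x) u (Metric.ball 0 ((j : ℝ) + 1)) := by
      intro y hy
      rw [mem_ball_zero_iff] at hy
      have : ‖(1 / ((j : ℝ) + 1)) • y‖ ≤ 1 := by
        rw [norm_smul, Real.norm_of_nonneg (by positivity), one_div_mul_eq_div,
          div_le_one (by positivity)]
        exact hy.le
      simp only [hχ1 _ this, one_mul]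
    rw [multiDeriv_eqOn Metric.isOpen_ball this α
      (by rw [mem_ball_zero_iff]; linarith), sub_self]

namespace SobolevSpace

variable {k : ℕ} {p : ℝ≥0∞} [Fact (1 ≤ p)]

theorem mem_closure_testFunctions_of_forall {U : Opens (RSpace n)}
    {f : SobolevSpace n k p (⊤ : Opens (RSpace n))}
    (h : ∀ ε : ℝ≥0∞, ε ≠ 0 → ∃ φ, IsTestFun U φ ∧ ∀ α : MultiIdx n k,
      eLpNorm (fun x => multiDeriv α.1 φ x - weakDeriv α f x) p volume ≤ ε) :
    f ∈ closure (testFunctions k p U ⊤) := by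
  choose φ hφ hle using fun j : ℕ => h ((j : ℝ≥0∞) + 1)⁻¹ (by simp [ENNReal.add_eq_top])
  refine mem_closure_testFunctions_iff.2 ⟨φ, hφ, fun α => ?_⟩
  simp only [eLpNorm_restrict_top]
  have hlim : Tendsto (fun j : ℕ => ((j : ℝ≥0∞) + 1)⁻¹) atTop (𝓝 0) := by
    have := (tendsto_add_atTop_iff_nat 1).2 ENNReal.tendsto_inv_nat_nhds_zero
    simpa using this
  exact tendsto_of_tendsto_of_tendsto_of_le_of_le tendsto_const_nhds hlim (fun _ => zero_le)
    fun j => hle j α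

theorem memLp_coe_top {q : ℝ≥0∞}
    (f : Lp ℂ q (volume.restrict ((⊤ : Opens (RSpace n)) : Set (RSpace n)))) :
    MemLp f q volume :=
  (Lp.memLp f).mono_measure (restrict_top_eq (n := n)).ge

/-- `C₀^∞(ℝⁿ)` is dense in `W^{k,p}(ℝⁿ)`. -/
theorem dense_testFunctions_top (hp : p ≠ ⊤) (f : SobolevSpace n k p (⊤ : Opens (RSpace n))) :
    f ∈ closure (testFunctions k p ⊤ ⊤) := by
  have hp1 : 1 ≤ p := Fact.out
  refine mem_closure_testFunctions_of_forall fun ε hε => ?_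
  have hε2 : ε / 2 ≠ 0 := by simpa using hε
  have hev : ∀ᶠ δ in 𝓝[>] (0 : ℝ), ∀ α : MultiIdx n k, ∀ ρ : ContDiffBump (0 : RSpace n),
      ρ.rOut ≤ δ → eLpNorm (fun x => (mollifier ρ ⋆[ContinuousLinearMap.mul ℝ ℂ, volume]
        weakDeriv α f) x - weakDeriv α f x) p volume ≤ ε / 2 :=
    eventually_all.2 fun α => eventually_eLpNorm_mollifier_sub_le hp1 hp
      (Lp.stronglyMeasurable _).measurable (memLp_coe_top _) hε2
  obtain ⟨δ, hδ, hδ0⟩ := (hev.and self_mem_nhdsWithin).exists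
  let ρ : ContDiffBump (0 : RSpace n) := ⟨δ / 2, δ, half_pos hδ0, half_lt_self hδ0⟩
  have hψ := mollifier_smoothCompact ρ
  have hfp : MemLp (toLp f) p volume := memLp_coe_top _
  have hfl := hfp.locallyIntegrable hp1
  set u := mollifier ρ ⋆[ContinuousLinearMap.mul ℝ ℂ, volume] toLp f with hu_def
  have hu : ContDiff ℝ ∞ u := contDiff_convolution hψ hfl
  have hDu : ∀ α : MultiIdx n k, eLpNorm (fun x => multiDeriv α.1 u x - weakDeriv α f x) p volume
      ≤ ε / 2 := by
    intro α
    rw [hu_def, multiDeriv_convolution_of_isWeakDeriv hψ hfl (isWeakDeriv α f)]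
    exact hδ α ρ le_rfl
  have hup := fun l => memLp_norm_iteratedFDeriv_convolution hp1 hp
    (Lp.stronglyMeasurable _).measurable hfp l hψ
  obtain ⟨χ, hχ, hχ1, -⟩ := exists_cutoff n
  have hcut : ∀ᶠ j : ℕ in atTop, ∀ α : MultiIdx n k, eLpNorm (fun x => multiDeriv α.1
      (fun x => χ ((1 / ((j : ℝ) + 1)) • x) * u x) x - multiDeriv α.1 u x) p volume ≤ ε / 2 :=
    eventually_all.2 fun α => (tendsto_eLpNorm_multiDeriv_cutoff hp1 hp hχ hχ1 hu hup
      α.1).eventually_le_const (pos_iff_ne_zero.2 hε2)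
  obtain ⟨j, hj⟩ := hcut.exists
  have hne : 1 / ((j : ℝ) + 1) ≠ 0 := by positivity
  have hs : ContDiff ℝ ∞ (fun x => χ ((1 / ((j : ℝ) + 1)) • x) * u x) :=
    (hχ.1.comp (contDiff_const_smul _)).mul hu
  refine ⟨fun x => χ ((1 / ((j : ℝ) + 1)) • x) * u x, isTestFun_top.2 ⟨hs,
    (hχ.2.comp_homeomorph (Homeomorph.smulOfNeZero _ hne)).mul_right⟩, fun α => ?_⟩
  have hsplit : (fun x => multiDeriv α.1 (fun x => χ ((1 / ((j : ℝ) + 1)) • x) * u x) x -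
      weakDeriv α f x) = (fun x => multiDeriv α.1
      (fun x => χ ((1 / ((j : ℝ) + 1)) • x) * u x) x - multiDeriv α.1 u x) +
      fun x => multiDeriv α.1 u x - weakDeriv α f x := by
    funext x
    simp
  have hm1 := (hs.multiDeriv α.1).continuous.aestronglyMeasurable (μ := volume)
  have hm2 := (hu.multiDeriv α.1).continuous.aestronglyMeasurable (μ := volume)
  rw [hsplit]
  refine (eLpNorm_add_le (hm1.sub hm2) (hm2.sub (memLp_coe_top (weakDeriv α f)).1) hp1).trans ?_
  exact (add_le_add (hj α) (hDu α)).trans_eq (ENNReal.add_halves ε)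

end SobolevSpace

end Density

/-! ### Averaged dyadic cutoffs near the origin -/

section CutoffNearZero

open Filter Topology

variable {n : ℕ}

/-- At each point at most one term is nonzero, so the `p`-th power passes inside the sum. The
averaging over scales owes its gain to this additivity. -/
theorem eLpNorm_sum_indicator_rpow {X ι : Type*} [MeasurableSpace X] {μ : Measure X} {p : ℝ≥0∞}
    (hp1 : 1 ≤ p) (hp : p ≠ ⊤) (s : Finset ι) {A : ι → Set X} (hA : ∀ j, MeasurableSet (A j))
    (hd : Pairwise (Function.onFun Disjoint A)) (c : ι → ℝ) :
    eLpNorm (fun x => ∑ j ∈ s, (A j).indicator (fun _ => c j) x) p μ ^ p.toReal =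
      ∑ j ∈ s, ‖c j‖ₑ ^ p.toReal * μ (A j) := by
  have hq0 : 0 < p.toReal := zero_lt_one.trans_le (one_le_toReal_of_one_le hp1 hp)
  have e : ∀ x, ‖∑ j ∈ s, (A j).indicator (fun _ => c j) x‖ₑ ^ p.toReal =
      ∑ j ∈ s, (A j).indicator (fun _ => ‖c j‖ₑ ^ p.toReal) x := by
    intro x
    by_cases hx : ∃ j ∈ s, x ∈ A j
    · obtain ⟨j, hj, hxj⟩ := hx
      have hne : ∀ i, i ≠ j → x ∉ A i := fun i hij hxi =>
        Set.disjoint_left.1 (hd hij) hxi hxj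
      rw [Finset.sum_eq_single_of_mem j hj fun i _ hij => indicator_of_notMem (hne i hij) _,
        Finset.sum_eq_single_of_mem j hj fun i _ hij => indicator_of_notMem (hne i hij) _,
        indicator_of_mem hxj, indicator_of_mem hxj]
    · push Not at hx
      rw [Finset.sum_eq_zero fun j hj => indicator_of_notMem (hx j hj) _,
        Finset.sum_eq_zero fun j hj => indicator_of_notMem (hx j hj) _, enorm_zero,
        ENNReal.zero_rpow_of_pos hq0]
  rw [eLpNorm_rpow_toReal hp1 hp]
  simp only [e]
  rw [lintegral_finsetSum _ fun j _ => measurable_const.indicator (hA j)]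
  exact Finset.sum_congr rfl fun j _ => lintegral_indicator_const (hA j) _

/-- The dyadic annulus `2⁻ʲ ≤ |x| < 2 · 2⁻ʲ`. -/
def dyadicAnnulus (n j : ℕ) : Set (RSpace n) := {x | 1 / 2 ^ j ≤ ‖x‖ ∧ ‖x‖ < 2 / 2 ^ j}

theorem measurableSet_dyadicAnnulus (j : ℕ) : MeasurableSet (dyadicAnnulus n j) :=
  (measurableSet_le measurable_const measurable_norm).inter
    (measurableSet_lt measurable_norm measurable_const)

theorem pairwise_disjoint_dyadicAnnulus :
    Pairwise (Function.onFun Disjoint (dyadicAnnulus n)) := by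
  have key : ∀ i j : ℕ, i < j → Disjoint (dyadicAnnulus n i) (dyadicAnnulus n j) := by
    intro i j hij
    refine Set.disjoint_left.2 fun x hi hj => ?_
    have h1 : (2 : ℝ) / 2 ^ j ≤ 1 / 2 ^ i := by
      rw [div_le_div_iff₀ (by positivity) (by positivity), one_mul, ← pow_succ']
      exact pow_le_pow_right₀ one_le_two hij
    exact absurd (hi.1.trans_lt hj.2) (not_lt.2 h1)
  intro i j hij
  rcases lt_or_gt_of_ne hij with h | h
  · exact key i j h
  · exact (key j i h).symm

theorem volume_dyadicAnnulus_le (j : ℕ) : volume (dyadicAnnulus n j) ≤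
    ENNReal.ofReal ((2 / 2 ^ j) ^ n) * volume (Metric.ball (0 : RSpace n) 1) := by
  refine (measure_mono fun x hx => ?_).trans_eq
    ((Measure.addHaar_ball_of_pos volume (0 : RSpace n) (r := 2 / 2 ^ j) (by positivity)).trans
      (by simp))
  exact mem_ball_zero_iff.2 hx.2

/-- Pointwise bound for the derivatives of a function, vanishing to order `m` at `0`, times a
cutoff at scale `2⁻ʲ`. -/
theorem exists_bound_multiDeriv_cutoff {m s : ℕ} (hms : 2 ≤ m + s) {χ φ : RSpace n → ℂ}
    (hχ : ContDiff ℝ ∞ χ ∧ HasCompactSupport χ) (hφ : ContDiff ℝ ∞ φ) {C : ℝ}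
    (hC : ∀ i ≤ 2, ∀ x, ‖iteratedFDeriv ℝ i φ x‖ ≤ C * ‖x‖ ^ (m - i)) (hm : m ≤ 2) :
    ∃ K : ℝ, 0 ≤ K ∧ ∀ (j : ℕ) (α : Fin n → ℕ), ∑ i, α i ≤ 2 → ∀ x, ‖x‖ ≤ 2 / 2 ^ j →
      ‖multiDeriv α (fun x => χ ((2 : ℝ) ^ j • x) * φ x) x‖ ≤ K * (2 ^ j) ^ s := by
  obtain ⟨D, hD0, hD⟩ := exists_bound_iteratedFDeriv hχ 2
  -- At order `2` the exponent `m - 2` is `0`, so the hypothesis at the origin itself gives the sign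
  -- of `C`.
  have hC0 : 0 ≤ C := by
    have h2 := hC 2 le_rfl 0
    have : m - 2 = 0 := by omega
    rw [this, pow_zero, mul_one] at h2
    exact (norm_nonneg _).trans h2
  refine ⟨∑ N ∈ Finset.range 3, ∑ i ∈ Finset.range (N + 1), (N.choose i : ℝ) * (D * C * 4),
    by positivity, fun j α hα x hx => ?_⟩
  set a : ℝ := 2 ^ j with ha
  have ha1 : 1 ≤ a := one_le_pow₀ one_le_two
  have ha0 : 0 < a := by positivity
  have hχs : ContDiff ℝ ∞ (fun x => χ (a • x)) := hχ.1.comp (contDiff_const_smul a)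
  refine (norm_multiDeriv_mul_le hχs hφ α x).trans ?_
  set N := ∑ i, α i with hN
  have hterm : ∀ i ∈ Finset.range (N + 1), (N.choose i : ℝ) *
      ‖iteratedFDeriv ℝ i (fun x => χ (a • x)) x‖ * ‖iteratedFDeriv ℝ (N - i) φ x‖ ≤
        (N.choose i : ℝ) * (D * C * 4) * a ^ s := by
    intro i hi
    have hi' : i ≤ N := by have := Finset.mem_range.1 hi; omega
    rw [norm_iteratedFDeriv_comp_smul hχ.1, abs_of_pos ha0]
    have hb : ‖iteratedFDeriv ℝ (N - i) φ x‖ ≤ C * (2 / a) ^ (m - (N - i)) := by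
      refine (hC (N - i) (by omega) x).trans ?_
      gcongr
    -- The exponent count is `i ≤ s + (m - (N - i))`, from `N ≤ 2 ≤ m + s`; it also holds when the
    -- subtraction truncates to `0`. The constant `4` bounds the power of `2`, whose exponent is at
    -- most `m ≤ 2`.
    have hpow : a ^ i * (2 / a) ^ (m - (N - i)) ≤ 4 * a ^ s := by
      rw [div_pow, mul_div_assoc', div_le_iff₀ (by positivity)]
      calc a ^ i * 2 ^ (m - (N - i)) ≤ a ^ (s + (m - (N - i))) * 2 ^ 2 := by
            gcongr <;> first | exact ha1 | exact one_le_two | omega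
        _ = 4 * a ^ s * a ^ (m - (N - i)) := by rw [pow_add]; ring
    calc (N.choose i : ℝ) * (a ^ i * ‖iteratedFDeriv ℝ i χ (a • x)‖) *
          ‖iteratedFDeriv ℝ (N - i) φ x‖
        ≤ (N.choose i : ℝ) * (a ^ i * D) * (C * (2 / a) ^ (m - (N - i))) := by
          gcongr
          exact hD i (by omega) _
      _ = (N.choose i : ℝ) * (D * C) * (a ^ i * (2 / a) ^ (m - (N - i))) := by ring
      _ ≤ (N.choose i : ℝ) * (D * C) * (4 * a ^ s) := by gcongr
      _ = (N.choose i : ℝ) * (D * C * 4) * a ^ s := by ring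
  refine (Finset.sum_le_sum hterm).trans ?_
  rw [← Finset.sum_mul]
  gcongr
  exact Finset.single_le_sum
    (f := fun N => ∑ i ∈ Finset.range (N + 1), (N.choose i : ℝ) * (D * C * 4))
    (fun N _ => by positivity) (Finset.mem_range.2 (by omega))

theorem multiDeriv_cutoff_of_norm_lt {χ φ : RSpace n → ℂ} (hχ1 : ∀ x, ‖x‖ ≤ 1 → χ x = 1) (j : ℕ)
    (α : Fin n → ℕ) {x : RSpace n} (hx : ‖x‖ < 1 / 2 ^ j) :
    multiDeriv α (fun x => χ ((2 : ℝ) ^ j • x) * φ x) x = multiDeriv α φ x := by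
  refine multiDeriv_eqOn (U := Metric.ball 0 (1 / 2 ^ j)) Metric.isOpen_ball (fun y hy => ?_) α
    (mem_ball_zero_iff.2 hx)
  rw [mem_ball_zero_iff, lt_div_iff₀ (by positivity)] at hy
  have : ‖(2 : ℝ) ^ j • y‖ ≤ 1 := by
    rw [norm_smul, Real.norm_of_nonneg (by positivity), mul_comm]
    exact hy.le
  simp only [hχ1 _ this, one_mul]

/-- The support radius `3 / 2 < 2` leaves room: the closed region `2ʲ‖x‖ ≥ 2` lies in an open set on
which the product vanishes, hence so do its derivatives. -/
theorem multiDeriv_cutoff_of_le_norm {χ φ : RSpace n → ℂ}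
    (hχ2 : tsupport χ ⊆ Metric.closedBall 0 (3 / 2)) (j : ℕ)
    (α : Fin n → ℕ) {x : RSpace n} (hx : 2 / 2 ^ j ≤ ‖x‖) :
    multiDeriv α (fun x => χ ((2 : ℝ) ^ j • x) * φ x) x = 0 := by
  have h := multiDeriv_eqOn (φ := fun x => χ ((2 : ℝ) ^ j • x) * φ x) (φ' := 0)
    (U := {y | 3 / 2 < ‖(2 : ℝ) ^ j • y‖})
    (isOpen_lt continuous_const (by fun_prop)) (fun y hy => ?_) α (x := x) ?_
  · rw [h, multiDeriv_zero_fun, Pi.zero_apply]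
  · have : χ ((2 : ℝ) ^ j • y) = 0 := image_eq_zero_of_notMem_tsupport fun hc => by
      have := hχ2 hc
      rw [mem_closedBall_zero_iff] at this
      exact absurd hy (not_lt.2 this)
    simp only [this, zero_mul, Pi.zero_apply]
  · rw [div_le_iff₀ (by positivity)] at hx
    change 3 / 2 < ‖(2 : ℝ) ^ j • x‖
    rw [norm_smul, Real.norm_of_nonneg (by positivity), mul_comm]
    linarith

/-- The annular part of the derivatives of the averaged cutoffs tends to zero in `L^p`. -/
theorem tendsto_eLpNorm_annular {p : ℝ≥0∞} (hp1 : 1 < p) (hp : p ≠ ⊤) {s : ℕ}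
    (hs : (s : ℝ) * p.toReal ≤ n) {K : ℝ} (hK : 0 ≤ K) :
    Tendsto (fun N : ℕ => eLpNorm (fun x : RSpace n => ∑ j ∈ Finset.Ico N (2 * N),
      (dyadicAnnulus n j).indicator (fun _ => (N : ℝ)⁻¹ * (K * (2 ^ j) ^ s)) x) p volume)
      atTop (𝓝 0) := by
  have hq1 : 1 < p.toReal := by
    simpa using (ENNReal.toReal_lt_toReal ENNReal.one_ne_top hp).2 hp1
  have hq0 : 0 < p.toReal := zero_lt_one.trans hq1
  set q := p.toReal with hq
  set V := volume (Metric.ball (0 : RSpace n) 1) with hV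
  have hVt : V ≠ ⊤ := Metric.isBounded_ball.measure_lt_top.ne
  -- On each annulus the factor `(2ʲ)^{sq}` is absorbed by the volume `O((2ʲ)^{-n})`, since `s q ≤
  -- n`. Each of the `N` annuli then contributes `O(N^{-q})`, in total `O(N^{1-q})`.
  have hbound : ∀ N : ℕ, 1 ≤ N → eLpNorm (fun x : RSpace n => ∑ j ∈ Finset.Ico N (2 * N),
      (dyadicAnnulus n j).indicator (fun _ => (N : ℝ)⁻¹ * (K * (2 ^ j) ^ s)) x) p volume ^ q ≤
      ENNReal.ofReal (K ^ q * 2 ^ n * (N : ℝ) ^ (1 - q)) * V := by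
    intro N hN
    have hN0 : (0 : ℝ) < N := by exact_mod_cast hN
    rw [eLpNorm_sum_indicator_rpow hp1.le hp _ measurableSet_dyadicAnnulus
      pairwise_disjoint_dyadicAnnulus]
    have hterm : ∀ j ∈ Finset.Ico N (2 * N), ‖(N : ℝ)⁻¹ * (K * (2 ^ j) ^ s)‖ₑ ^ q *
        volume (dyadicAnnulus n j) ≤ ENNReal.ofReal ((N : ℝ)⁻¹ ^ q * K ^ q * 2 ^ n) * V := by
      intro j _
      refine (mul_le_mul_right (volume_dyadicAnnulus_le j) _).trans ?_
      rw [← mul_assoc]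
      gcongr
      have h0 : 0 ≤ (N : ℝ)⁻¹ * (K * (2 ^ j) ^ s) := by positivity
      rw [Real.enorm_eq_ofReal h0, ENNReal.ofReal_rpow_of_nonneg h0 hq0.le,
        ← ENNReal.ofReal_mul (by positivity)]
      refine ENNReal.ofReal_le_ofReal ?_
      rw [Real.mul_rpow (by positivity) (by positivity),
        Real.mul_rpow (by positivity) (by positivity), div_pow]
      have h2 : (((2 : ℝ) ^ j) ^ s) ^ q ≤ (2 ^ j) ^ n := by
        rw [← Real.rpow_natCast _ s, ← Real.rpow_mul (by positivity), ← Real.rpow_natCast _ n]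
        exact Real.rpow_le_rpow_of_exponent_le (one_le_pow₀ one_le_two) hs
      calc (N : ℝ)⁻¹ ^ q * (K ^ q * (((2 : ℝ) ^ j) ^ s) ^ q) * (2 ^ n / (2 ^ j) ^ n)
          ≤ (N : ℝ)⁻¹ ^ q * (K ^ q * (2 ^ j) ^ n) * (2 ^ n / (2 ^ j) ^ n) := by gcongr
        _ = (N : ℝ)⁻¹ ^ q * K ^ q * 2 ^ n := by field_simp
    refine (Finset.sum_le_sum hterm).trans (le_of_eq ?_)
    rw [Finset.sum_const, Nat.card_Ico, nsmul_eq_mul, ← mul_assoc,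
      show 2 * N - N = N by omega, ← ENNReal.ofReal_natCast, ← ENNReal.ofReal_mul hN0.le]
    congr 2
    rw [Real.rpow_sub hN0, Real.rpow_one, Real.inv_rpow hN0.le]
    field_simp
  have hlim : Tendsto (fun N : ℕ => ENNReal.ofReal (K ^ q * 2 ^ n * (N : ℝ) ^ (1 - q)) * V)
      atTop (𝓝 0) := by
    have h1 : Tendsto (fun N : ℕ => (N : ℝ) ^ (1 - q)) atTop (𝓝 0) := by
      have := (tendsto_rpow_neg_atTop (y := q - 1) (by linarith)).comp
        (tendsto_natCast_atTop_atTop (R := ℝ))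
      simpa [Function.comp_def] using this
    have h2 := ENNReal.tendsto_ofReal (h1.const_mul (K ^ q * 2 ^ n))
    have h3 := ENNReal.Tendsto.mul_const h2 (Or.inr hVt)
    simpa using h3
  have hpow := tendsto_of_tendsto_of_tendsto_of_le_of_le' tendsto_const_nhds hlim
    (.of_forall fun _ => zero_le) ((eventually_ge_atTop 1).mono hbound)
  have h2 := hpow.ennrpow_const q⁻¹
  rw [ENNReal.zero_rpow_of_pos (inv_pos.2 hq0)] at h2
  refine h2.congr fun N => ?_
  rw [← ENNReal.rpow_mul, mul_inv_cancel₀ hq0.ne', ENNReal.rpow_one]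

theorem tendsto_eLpNorm_indicator_ball (hn : 1 ≤ n) {p : ℝ≥0∞} (hp1 : 1 ≤ p) (hp : p ≠ ⊤)
    (K : ℝ) :
    Tendsto (fun N : ℕ => eLpNorm ((Metric.ball (0 : RSpace n) (1 / 2 ^ N)).indicator
      fun _ => K) p volume) atTop (𝓝 0) := by
  have h0 : p ≠ 0 := (zero_lt_one.trans_le hp1).ne'
  have hq0 : 0 < p.toReal := ENNReal.toReal_pos h0 hp
  simp only [eLpNorm_indicator_const Metric.isOpen_ball.measurableSet h0 hp]
  have hv : Tendsto (fun N : ℕ => volume (Metric.ball (0 : RSpace n) (1 / 2 ^ N))) atTop (𝓝 0) := by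
    have h1 : Tendsto (fun N : ℕ => ENNReal.ofReal (((1 : ℝ) / 2 ^ N) ^ n)) atTop (𝓝 0) := by
      have h2 : Tendsto (fun N : ℕ => ((1 : ℝ) / 2 ^ N)) atTop (𝓝 0) := by
        have := tendsto_pow_atTop_nhds_zero_of_lt_one (r := (1 / 2 : ℝ)) (by norm_num)
          (by norm_num)
        simpa [div_pow] using this
      have h3 := ENNReal.tendsto_ofReal (h2.pow n)
      rwa [zero_pow (by omega), ENNReal.ofReal_zero] at h3
    have h4 := ENNReal.Tendsto.mul_const h1 (b := volume (Metric.ball (0 : RSpace n) 1))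
      (Or.inr Metric.isBounded_ball.measure_lt_top.ne)
    rw [zero_mul] at h4
    refine h4.congr fun N => ?_
    rw [Measure.addHaar_ball_of_pos volume (0 : RSpace n)
      (r := 1 / 2 ^ N) (by positivity)]
    simp
  have h5 := ENNReal.Tendsto.const_mul (hv.ennrpow_const (1 / p.toReal)) (a := ‖K‖ₑ)
    (Or.inr enorm_ne_top)
  rwa [ENNReal.zero_rpow_of_pos (by positivity), mul_zero] at h5

/-- A test function vanishing to order `m` at the origin is approximated in `W^{2,p}` by test
functions supported away from the origin, if `(2 - m) p ≤ n`. -/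
theorem exists_testFun_punctured_approx (hn : 1 ≤ n) {p : ℝ≥0∞} (hp1 : 1 < p) (hp : p ≠ ⊤)
    {m s : ℕ} (hms : 2 ≤ m + s) (hm : m ≤ 2) (hs : (s : ℝ) * p.toReal ≤ n) {φ : RSpace n → ℂ}
    (hφ : ContDiff ℝ ∞ φ ∧ HasCompactSupport φ) {C : ℝ}
    (hC : ∀ i ≤ 2, ∀ x, ‖iteratedFDeriv ℝ i φ x‖ ≤ C * ‖x‖ ^ (m - i)) {ε : ℝ≥0∞} (hε : ε ≠ 0) :
    ∃ ψ, IsTestFun (punctured n) ψ ∧ ∀ α : Fin n → ℕ, ∑ i, α i ≤ 2 →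
      eLpNorm (fun x => multiDeriv α ψ x - multiDeriv α φ x) p volume ≤ ε := by
  obtain ⟨χ, hχ, hχ1, hχ2⟩ := exists_cutoff n
  obtain ⟨K, hK0, hK⟩ := exists_bound_multiDeriv_cutoff hms hχ hφ.1 hC hm
  obtain ⟨L, hL0, hL⟩ := exists_bound_iteratedFDeriv hφ 2
  have hε2 : 0 < ε / 2 := ENNReal.div_pos hε ENNReal.ofNat_ne_top
  obtain ⟨N, hN1, hNA, hNB⟩ := ((eventually_ge_atTop 1).and
    (((tendsto_eLpNorm_annular hp1 hp hs hK0).eventually_le_const hε2).and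
    ((tendsto_eLpNorm_indicator_ball hn hp1.le hp L).eventually_le_const hε2))).exists
  have hN0 : (0 : ℝ) < N := by exact_mod_cast hN1
  have hcard : (Finset.Ico N (2 * N)).card = N := by rw [Nat.card_Ico]; omega
  let ζ : ℕ → RSpace n → ℂ := fun j x => χ ((2 : ℝ) ^ j • x) * φ x
  have hχs : ∀ j : ℕ, ContDiff ℝ ∞ fun x : RSpace n => χ ((2 : ℝ) ^ j • x) := fun j =>
    hχ.1.comp (contDiff_const_smul _)
  have hζ : ∀ j, ContDiff ℝ ∞ (ζ j) := fun j => (hχs j).mul hφ.1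
  -- The average of the `N` truncations of `φ` at the scales `2⁻ʲ`, `N ≤ j < 2N`; it is to be small
  -- in `W^{2,p}` and equal to `φ` near `0`.
  let Θ : RSpace n → ℂ := fun x => ∑ j ∈ Finset.Ico N (2 * N), (N : ℂ)⁻¹ * ζ j x
  have hΘ : ContDiff ℝ ∞ Θ := ContDiff.sum fun j _ => contDiff_const.mul (hζ j)
  let ψ : RSpace n → ℂ := fun x => φ x - Θ x
  have hψeq : ψ = fun x =>
      (1 - ∑ j ∈ Finset.Ico N (2 * N), (N : ℂ)⁻¹ * χ ((2 : ℝ) ^ j • x)) * φ x := by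
    funext x
    simp only [ψ, Θ, ζ, sub_mul, one_mul, Finset.sum_mul, mul_assoc]
  refine ⟨ψ, ⟨hφ.1.sub hΘ, ?_, ?_⟩, fun α hα => ?_⟩
  · rw [hψeq]
    exact hφ.2.mul_left
  · intro x hx hx0
    rw [mem_singleton_iff] at hx0
    subst hx0
    -- Within radius `2^{-2N}` all the cutoffs in the average equal `1`.
    have : ψ =ᶠ[𝓝 0] 0 := by
      filter_upwards [Metric.ball_mem_nhds (0 : RSpace n)
        (show (0 : ℝ) < 1 / 2 ^ (2 * N) by positivity)] with y hy
      rw [mem_ball_zero_iff, lt_div_iff₀ (by positivity)] at hy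
      have hone : ∀ j ∈ Finset.Ico N (2 * N), (N : ℂ)⁻¹ * χ ((2 : ℝ) ^ j • y) = (N : ℂ)⁻¹ := by
        intro j hj
        rw [hχ1, mul_one]
        rw [norm_smul, Real.norm_of_nonneg (by positivity), mul_comm]
        refine le_trans ?_ hy.le
        gcongr
        · exact one_le_two
        · exact (Finset.mem_Ico.1 hj).2.le
      have hNc : (N : ℂ) ≠ 0 := by exact_mod_cast hN0.ne'
      simp only [hψeq, Finset.sum_congr rfl hone, Finset.sum_const, hcard, nsmul_eq_mul,
        mul_inv_cancel₀ hNc, sub_self, zero_mul, Pi.zero_apply]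
    exact (notMem_tsupport_iff_eventuallyEq.2 this) hx
  · have hdiff : ∀ x, multiDeriv α ψ x - multiDeriv α φ x =
        -∑ j ∈ Finset.Ico N (2 * N), (N : ℂ)⁻¹ * multiDeriv α (ζ j) x := by
      intro x
      have h1 := multiDeriv_sub hφ.1 hΘ α x
      have h2 := multiDeriv_sum_const_mul (Finset.Ico N (2 * N)) (fun _ => (N : ℂ)⁻¹) hζ α x
      simp only [ψ, h1, Θ, h2]
      ring
    have hpt : ∀ x, ‖multiDeriv α ψ x - multiDeriv α φ x‖ ≤
        (Metric.ball (0 : RSpace n) (1 / 2 ^ N)).indicator (fun _ => L) x +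
        ∑ j ∈ Finset.Ico N (2 * N),
          (dyadicAnnulus n j).indicator (fun _ => (N : ℝ)⁻¹ * (K * (2 ^ j) ^ s)) x := by
      intro x
      rw [hdiff, norm_neg]
      refine (norm_sum_le _ _).trans ?_
      -- Three zones: for `‖x‖ < 2⁻ʲ` only `D^α φ` remains, and `x` lies in the ball of radius
      -- `2^{-N}` as `N ≤ j`; on the annulus the scale bound holds; beyond it the term vanishes. The
      -- factor `N⁻¹` makes the `N` ball terms add up to a single one.
      have hterm : ∀ j ∈ Finset.Ico N (2 * N), ‖(N : ℂ)⁻¹ * multiDeriv α (ζ j) x‖ ≤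
          (N : ℝ)⁻¹ * (Metric.ball (0 : RSpace n) (1 / 2 ^ N)).indicator (fun _ => L) x +
          (dyadicAnnulus n j).indicator (fun _ => (N : ℝ)⁻¹ * (K * (2 ^ j) ^ s)) x := by
        intro j hj
        have hnn1 : 0 ≤ (Metric.ball (0 : RSpace n) (1 / 2 ^ N)).indicator (fun _ => L) x :=
          indicator_nonneg (fun _ _ => hL0) x
        have hnn2 : 0 ≤ (dyadicAnnulus n j).indicator
            (fun _ => (N : ℝ)⁻¹ * (K * (2 ^ j) ^ s)) x :=
          indicator_nonneg (fun _ _ => by positivity) x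
        rw [norm_mul, norm_inv, Complex.norm_natCast]
        rcases lt_or_ge ‖x‖ (1 / 2 ^ j) with h1 | h1
        · have hb : x ∈ Metric.ball (0 : RSpace n) (1 / 2 ^ N) := by
            rw [mem_ball_zero_iff]
            refine h1.trans_le ?_
            gcongr
            · exact one_le_two
            · exact (Finset.mem_Ico.1 hj).1
          have h3 : ‖multiDeriv α (ζ j) x‖ ≤ L := by
            rw [show multiDeriv α (ζ j) x = multiDeriv α φ x from
              multiDeriv_cutoff_of_norm_lt hχ1 j α h1]
            exact (norm_multiDeriv_le hφ.1 α x).trans (hL _ hα x)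
          rw [indicator_of_mem hb]
          have : (N : ℝ)⁻¹ * ‖multiDeriv α (ζ j) x‖ ≤ (N : ℝ)⁻¹ * L := by gcongr
          linarith
        · rcases lt_or_ge ‖x‖ (2 / 2 ^ j) with h2 | h2
          · have hA : x ∈ dyadicAnnulus n j := ⟨h1, h2⟩
            rw [indicator_of_mem hA]
            have h3 : ‖multiDeriv α (ζ j) x‖ ≤ K * (2 ^ j) ^ s := hK j α hα x h2.le
            have : (N : ℝ)⁻¹ * ‖multiDeriv α (ζ j) x‖ ≤ (N : ℝ)⁻¹ * (K * (2 ^ j) ^ s) := by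
              gcongr
            have h4 : 0 ≤ (N : ℝ)⁻¹ *
              (Metric.ball (0 : RSpace n) (1 / 2 ^ N)).indicator (fun _ => L) x := by positivity
            linarith
          · rw [show multiDeriv α (ζ j) x = 0 from multiDeriv_cutoff_of_le_norm hχ2 j α h2,
              norm_zero, mul_zero]
            positivity
      refine (Finset.sum_le_sum hterm).trans (le_of_eq ?_)
      rw [Finset.sum_add_distrib, Finset.sum_const, hcard, nsmul_eq_mul, ← mul_assoc,
        mul_inv_cancel₀ hN0.ne', one_mul]
    refine (eLpNorm_mono_real hpt).trans ?_
    refine (eLpNorm_add_le ?_ ?_ hp1.le).trans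
      ((add_le_add hNB hNA).trans_eq (ENNReal.add_halves ε))
    · exact aestronglyMeasurable_const.indicator Metric.isOpen_ball.measurableSet
    · exact (Finset.measurable_sum _ fun j _ =>
        measurable_const.indicator (measurableSet_dyadicAnnulus j)).aestronglyMeasurable

namespace SobolevSpace

theorem ofSmooth_mem_closure_punctured (hn : 1 ≤ n) {p : ℝ≥0∞} [Fact (1 ≤ p)] (hp1 : 1 < p)
    (hp : p ≠ ⊤) {m s : ℕ} (hms : 2 ≤ m + s) (hm : m ≤ 2) (hs : (s : ℝ) * p.toReal ≤ n)
    {φ : RSpace n → ℂ} (hφ : ContDiff ℝ ∞ φ ∧ HasCompactSupport φ) {C : ℝ}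
    (hC : ∀ i ≤ 2, ∀ x, ‖iteratedFDeriv ℝ i φ x‖ ≤ C * ‖x‖ ^ (m - i)) :
    ofSmooth n 2 p ⊤ hφ ∈ closure (testFunctions 2 p (punctured n) ⊤) := by
  refine mem_closure_testFunctions_of_forall fun ε hε => ?_
  obtain ⟨ψ, hψ, hle⟩ := exists_testFun_punctured_approx hn hp1 hp hms hm hs hφ hC hε
  refine ⟨ψ, hψ, fun α => le_trans (le_of_eq ?_) (hle α.1 ((mem_multiIdx_iff _).1 α.2))⟩
  have h := weakDeriv_ofSmooth_ae_eq (k := 2) (p := p) (Ω := ⊤) hφ α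
  rw [ae_eq_restrict_top_iff] at h
  refine eLpNorm_congr_ae ?_
  filter_upwards [h] with x hx
  rw [hx]

end SobolevSpace

end CutoffNearZero

/-! ### Sobolev inequalities by averaging over scales -/

section SobolevEmbedding

open Filter Topology

variable {n : ℕ}

theorem lintegral_comp_add_smul {f : RSpace n → ℝ≥0∞} (hf : Measurable f) (x₀ : RSpace n) {t : ℝ}
    (ht : 0 < t) :
    ∫⁻ y, f (x₀ + t • y) = ENNReal.ofReal (t ^ n)⁻¹ * ∫⁻ y, f y := by
  have h1 : ∫⁻ y, f (x₀ + t • y) = ∫⁻ z, f (x₀ + z) ∂(Measure.map (t • ·) volume) :=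
    (lintegral_map (hf.comp (measurable_const_add x₀)) (measurable_const_smul t)).symm
  rw [h1, Measure.map_addHaar_smul volume ht.ne', lintegral_smul_measure,
    lintegral_add_left_eq_self f x₀, finrank_euclideanSpace_fin, abs_of_nonneg (by positivity),
    smul_eq_mul]

theorem eLpNorm_comp_add_smul {p : ℝ≥0∞} (hp1 : 1 ≤ p) (hp : p ≠ ⊤) {ψ : RSpace n → ℂ}
    (hψ : Continuous ψ) (x₀ : RSpace n) {t : ℝ} (ht : 0 < t) :
    eLpNorm (fun y => ψ (x₀ + t • y)) p volume =
      ENNReal.ofReal (t ^ (-(n / p.toReal))) * eLpNorm ψ p volume := by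
  have h0 : p ≠ 0 := (zero_lt_one.trans_le hp1).ne'
  have hq0 : 0 < p.toReal := ENNReal.toReal_pos h0 hp
  rw [eLpNorm_eq_lintegral_rpow_enorm_toReal h0 hp, eLpNorm_eq_lintegral_rpow_enorm_toReal h0 hp,
    lintegral_comp_add_smul (f := fun y => ‖ψ y‖ₑ ^ p.toReal)
      (hψ.measurable.enorm.pow_const _) x₀ ht,
    ENNReal.mul_rpow_of_nonneg _ _ (by positivity),
    ENNReal.ofReal_rpow_of_nonneg (by positivity) (by positivity)]
  congr 2
  rw [← Real.rpow_natCast, ← Real.rpow_neg ht.le, ← Real.rpow_mul ht.le]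
  congr 1
  ring

/-- The weighted average `∫ ψ(x₀ + t y) w(y) dy` of `ψ` at scale `t` about `x₀`. -/
def scaledAverage (ψ w : RSpace n → ℂ) (x₀ : RSpace n) (t : ℝ) : ℂ :=
  ∫ y, ψ (x₀ + t • y) * w y

/-- Hölder against the fixed weight; the dilation `y ↦ x₀ + t y` multiplies the `L^p` norm by
`t^{-n/p}`. -/
theorem norm_scaledAverage_le {p : ℝ≥0∞} (hp1 : 1 ≤ p) (hp : p ≠ ⊤) {ψ w : RSpace n → ℂ}
    (hψ : ContDiff ℝ ∞ ψ ∧ HasCompactSupport ψ) (hw : Continuous w ∧ HasCompactSupport w)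
    (x₀ : RSpace n) {t : ℝ} (ht : 0 < t) :
    ‖scaledAverage ψ w x₀ t‖ ≤ (eLpNorm w (ENNReal.conjExponent p) volume).toReal *
      (eLpNorm ψ p volume).toReal * t ^ (-(n / p.toReal)) := by
  have hq : ENNReal.HolderConjugate p (ENNReal.conjExponent p) :=
    ENNReal.HolderConjugate.conjExponent hp1
  have hwm : MemLp w (ENNReal.conjExponent p) volume :=
    hw.1.memLp_of_hasCompactSupport hw.2
  have hψm := memLp_of_smoothCompact hψ volume p
  have hcont : Continuous fun y => ψ (x₀ + t • y) := hψ.1.continuous.comp (by fun_prop)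
  have h1 := eLpNorm_smul_le_mul_eLpNorm (p := p) (q := ENNReal.conjExponent p) (r := 1)
    hwm.1 hcont.aestronglyMeasurable (μ := volume)
  rw [eLpNorm_comp_add_smul hp1 hp hψ.1.continuous x₀ ht, eLpNorm_one_eq_lintegral_enorm] at h1
  have h2 : ‖scaledAverage ψ w x₀ t‖ₑ ≤ ENNReal.ofReal (t ^ (-(n / p.toReal))) *
      eLpNorm ψ p volume * eLpNorm w (ENNReal.conjExponent p) volume :=
    (enorm_integral_le_lintegral_enorm _).trans h1
  have h3 := ENNReal.toReal_mono (ENNReal.mul_ne_top (ENNReal.mul_ne_top ENNReal.ofReal_ne_top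
    hψm.2.ne) hwm.2.ne) h2
  rw [toReal_enorm, ENNReal.toReal_mul, ENNReal.toReal_mul,
    ENNReal.toReal_ofReal (by positivity)] at h3
  linarith

theorem continuousCompact_coord_mul {w : RSpace n → ℂ} (hw : Continuous w ∧ HasCompactSupport w)
    (i : Fin n) :
    Continuous (fun y : RSpace n => (y i : ℂ) * w y) ∧
      HasCompactSupport (fun y : RSpace n => (y i : ℂ) * w y) :=
  ⟨(Complex.continuous_ofReal.comp (by fun_prop)).mul hw.1, hw.2.mul_left⟩

theorem fderiv_apply_eq_sum {ψ : RSpace n → ℂ} (x y : RSpace n) :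
    fderiv ℝ ψ x y = ∑ i, (y i : ℂ) * partialDeriv i ψ x := by
  conv_lhs => rw [← (EuclideanSpace.basisFun (Fin n) ℝ).sum_repr y]
  simp [partialDeriv]

/-- Differentiation under the integral brings out `∑ y_i D_i ψ`. The factors `y_i` go into the
weight, which stays continuous with compact support, so the lemma can be iterated. -/
theorem hasDerivAt_scaledAverage {ψ w : RSpace n → ℂ}
    (hψ : ContDiff ℝ ∞ ψ ∧ HasCompactSupport ψ) (hw : Continuous w ∧ HasCompactSupport w)
    (x₀ : RSpace n) (t : ℝ) :
    HasDerivAt (scaledAverage ψ w x₀)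
      (∑ i, scaledAverage (partialDeriv i ψ) (fun y => (y i : ℂ) * w y) x₀ t) t := by
  obtain ⟨C, hC0, hC⟩ := exists_bound_iteratedFDeriv hψ 1
  have hd : Differentiable ℝ ψ := hψ.1.differentiable (by simp)
  have hfc : Continuous (fderiv ℝ ψ) := hψ.1.continuous_fderiv (by simp)
  have hfb : ∀ x, ‖fderiv ℝ ψ x‖ ≤ C := fun x => by
    rw [← norm_iteratedFDeriv_one]
    exact hC 1 le_rfl x
  have hcs : ∀ {ψ w : RSpace n → ℂ}, Continuous ψ → Continuous w → HasCompactSupport w → ∀ s : ℝ,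
      Integrable (fun y => ψ (x₀ + s • y) * w y) volume := by
    intro ψ w hψ hw hws s
    have h1 : Continuous fun y => ψ (x₀ + s • y) := hψ.comp (by fun_prop)
    exact (h1.mul hw).integrable_of_hasCompactSupport hws.mul_left
  have key := hasDerivAt_integral_of_dominated_loc_of_deriv_le (μ := (volume : Measure (RSpace n)))
    (F := fun (s : ℝ) y => ψ (x₀ + s • y) * w y)
    (F' := fun (s : ℝ) y => fderiv ℝ ψ (x₀ + s • y) y * w y)
    (bound := fun y => C * ‖y‖ * ‖w y‖) (x₀ := t) (s := univ) univ_mem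
    (.of_forall fun s => (hcs hψ.1.continuous hw.1 hw.2 s).1)
    (hcs hψ.1.continuous hw.1 hw.2 t) ?_ ?_ ?_ ?_
  · refine HasDerivAt.congr_deriv (f := scaledAverage ψ w x₀) key.2 ?_
    simp only [fderiv_apply_eq_sum, Finset.sum_mul]
    rw [integral_finsetSum]
    · refine Finset.sum_congr rfl fun i _ => integral_congr_ae (.of_forall fun y => ?_)
      simp only
      ring
    · intro i _
      have := hcs (hψ.1.partialDeriv i).continuous (continuousCompact_coord_mul hw i).1
        (continuousCompact_coord_mul hw i).2 t
      refine this.congr (.of_forall fun y => ?_)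
      simp only
      ring
  · have h1 : Continuous fun y => fderiv ℝ ψ (x₀ + t • y) y :=
      (hfc.comp (by fun_prop)).clm_apply continuous_id
    exact (h1.mul hw.1).aestronglyMeasurable
  · refine .of_forall fun y s _ => ?_
    rw [norm_mul]
    gcongr
    exact (ContinuousLinearMap.le_opNorm _ _).trans
      (mul_le_mul_of_nonneg_right (hfb _) (norm_nonneg y))
  · exact ((continuous_const.mul continuous_norm).mul
      hw.1.norm).integrable_of_hasCompactSupport hw.2.norm.mul_left
  · refine .of_forall fun y s _ => ?_
    have h1 : HasDerivAt (fun s : ℝ => x₀ + s • y) y s := by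
      simpa using ((hasDerivAt_id s).smul_const y).const_add x₀
    exact ((hd (x₀ + s • y)).hasFDerivAt.comp_hasDerivAt s h1).mul_const (w y)

/-- `t^{-σ}` is integrable at `0` for `σ < 1`. The bound may blow up at `0`, so `b` is compared with
an explicit primitive on `[δ, 1]` before `δ → 0`. -/
theorem norm_le_of_norm_deriv_le_rpow {b b' : ℝ → ℂ} (hb : ∀ t, HasDerivAt b (b' t) t) {K σ : ℝ}
    (hK : 0 ≤ K) (hσ : σ < 1) (hle : ∀ t, 0 < t → t < 1 → ‖b' t‖ ≤ K * t ^ (-σ)) :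
    ‖b 0‖ ≤ ‖b 1‖ + K / (1 - σ) := by
  have h1σ : 0 < 1 - σ := by linarith
  have hδ : ∀ δ, 0 < δ → δ < 1 → ‖b 1 - b δ‖ ≤ K / (1 - σ) := by
    intro δ hδ0 hδ1
    have hB : ∀ t, 0 < t → HasDerivAt
        (fun t => K / (1 - σ) * t ^ (1 - σ) - K / (1 - σ) * δ ^ (1 - σ)) (K * t ^ (-σ)) t := by
      intro t ht
      have := ((Real.hasDerivAt_rpow_const (x := t) (p := 1 - σ) (Or.inl ht.ne')).const_mul
        (K / (1 - σ))).sub_const (K / (1 - σ) * δ ^ (1 - σ))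
      refine this.congr_deriv ?_
      rw [show 1 - σ - 1 = -σ by ring]
      field_simp
    have h := image_norm_le_of_norm_deriv_right_le_deriv_boundary' (f := fun t => b t - b δ)
      (f' := b') (a := δ) (b := 1)
      (fun t _ => ((hb t).continuousAt.sub continuousAt_const).continuousWithinAt)
      (fun t _ => ((hb t).sub_const (b δ)).hasDerivWithinAt)
      (B := fun t => K / (1 - σ) * t ^ (1 - σ) - K / (1 - σ) * δ ^ (1 - σ))
      (B' := fun t => K * t ^ (-σ)) (by simp)
      (fun t ht => (hB t (hδ0.trans_le ht.1)).continuousAt.continuousWithinAt)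
      (fun t ht => (hB t (hδ0.trans_le ht.1)).hasDerivWithinAt)
      (fun t ht => hle t (hδ0.trans_le ht.1) ht.2) (right_mem_Icc.2 hδ1.le)
    refine h.trans ?_
    rw [Real.one_rpow, mul_one]
    have : 0 ≤ K / (1 - σ) * δ ^ (1 - σ) := by positivity
    linarith
  have hlim : Tendsto (fun δ => ‖b 1 - b δ‖) (𝓝[>] 0) (𝓝 ‖b 1 - b 0‖) :=
    ((continuousAt_const.sub (hb 0).continuousAt).norm).tendsto.mono_left nhdsWithin_le_nhds
  have h0 : ‖b 1 - b 0‖ ≤ K / (1 - σ) := by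
    refine le_of_tendsto hlim ?_
    filter_upwards [Ioo_mem_nhdsGT (zero_lt_one' ℝ)] with δ hδ'
    exact hδ δ hδ'.1 hδ'.2
  calc ‖b 0‖ = ‖b 1 - (b 1 - b 0)‖ := by rw [sub_sub_cancel]
    _ ≤ ‖b 1‖ + ‖b 1 - b 0‖ := norm_sub_le _ _
    _ ≤ _ := by gcongr

theorem exists_unit_weight (n : ℕ) :
    ∃ w : RSpace n → ℂ, (Continuous w ∧ HasCompactSupport w) ∧ ∫ y, w y = 1 := by
  let ρ : ContDiffBump (0 : RSpace n) := ⟨1, 2, one_pos, one_lt_two⟩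
  refine ⟨mollifier ρ, ⟨(mollifier_smoothCompact ρ).1.continuous, (mollifier_smoothCompact ρ).2⟩,
    ?_⟩
  unfold mollifier
  rw [integral_complex_ofReal, ρ.integral_normed, Complex.ofReal_one]

theorem scaledAverage_zero {ψ w : RSpace n → ℂ} (hw : ∫ y, w y = 1) (x₀ : RSpace n) :
    scaledAverage ψ w x₀ 0 = ψ x₀ := by
  simp only [scaledAverage, zero_smul, add_zero]
  rw [integral_const_mul, hw, mul_one]

/-- The Sobolev inequality `‖φ‖_∞ ≤ C ‖φ‖_{W^{1,p}}` for `p > n`. -/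
theorem exists_sobolev_bound_one {p : ℝ≥0∞} (hp1 : 1 ≤ p) (hp : p ≠ ⊤)
    (hnp : (n : ℝ) < p.toReal) :
    ∃ C : ℝ, 0 ≤ C ∧ ∀ (φ : RSpace n → ℂ) (M : ℝ), ContDiff ℝ ∞ φ ∧ HasCompactSupport φ →
      (eLpNorm φ p volume).toReal ≤ M →
      (∀ i, (eLpNorm (partialDeriv i φ) p volume).toReal ≤ M) → ∀ x, ‖φ x‖ ≤ C * M := by
  obtain ⟨w, hw, hw1⟩ := exists_unit_weight n
  have hq0 : 0 < p.toReal := zero_lt_one.trans_le (one_le_toReal_of_one_le hp1 hp)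
  set σ : ℝ := n / p.toReal with hσ
  have hσ1 : σ < 1 := (div_lt_one hq0).2 hnp
  have h1σ : 0 < 1 - σ := by linarith
  let W : (RSpace n → ℂ) → ℝ := fun w => (eLpNorm w (ENNReal.conjExponent p) volume).toReal
  let S : ℝ := ∑ i : Fin n, W (fun y => (y i : ℂ) * w y)
  have hS : 0 ≤ S := Finset.sum_nonneg fun i _ => ENNReal.toReal_nonneg
  refine ⟨W w + S / (1 - σ), add_nonneg ENNReal.toReal_nonneg (div_nonneg hS h1σ.le),
    fun φ M hφ hM0 hM1 x => ?_⟩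
  have hM : 0 ≤ M := ENNReal.toReal_nonneg.trans hM0
  -- The average equals `φ x` at `t = 0`, and its derivative is at most `S M t^{-n/p}` with `n / p <
  -- 1`.
  have h := norm_le_of_norm_deriv_le_rpow (hasDerivAt_scaledAverage hφ hw x) (K := S * M)
    (mul_nonneg hS hM) hσ1 fun t ht _ => ?_
  · rw [scaledAverage_zero hw1] at h
    refine h.trans ?_
    have h1 := norm_scaledAverage_le hp1 hp hφ hw x one_pos
    rw [Real.one_rpow, mul_one] at h1
    have h2 : ‖scaledAverage φ w x 1‖ ≤ W w * M :=
      h1.trans (mul_le_mul_of_nonneg_left hM0 ENNReal.toReal_nonneg)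
    calc _ ≤ W w * M + S * M / (1 - σ) := by gcongr
      _ = _ := by ring
  · refine (norm_sum_le _ _).trans ?_
    simp only [S, Finset.sum_mul]
    refine Finset.sum_le_sum fun i _ => ?_
    refine (norm_scaledAverage_le hp1 hp (smoothCompact_partialDeriv i hφ)
      (continuousCompact_coord_mul hw i) x ht).trans ?_
    gcongr
    exact hM1 i

/-- The Sobolev inequality `‖φ‖_∞ ≤ C ‖φ‖_{W^{2,p}}` for `p > n / 2`. -/
theorem exists_sobolev_bound_two {p : ℝ≥0∞} (hp1 : 1 ≤ p) (hp : p ≠ ⊤)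
    (hnp : (n : ℝ) < 2 * p.toReal) :
    ∃ C : ℝ, 0 ≤ C ∧ ∀ (φ : RSpace n → ℂ) (M : ℝ), ContDiff ℝ ∞ φ ∧ HasCompactSupport φ →
      (eLpNorm φ p volume).toReal ≤ M →
      (∀ i, (eLpNorm (partialDeriv i φ) p volume).toReal ≤ M) →
      (∀ i j, (eLpNorm (partialDeriv j (partialDeriv i φ)) p volume).toReal ≤ M) →
      ∀ x, ‖φ x‖ ≤ C * M := by
  obtain ⟨w, hw, hw1⟩ := exists_unit_weight n
  have hq0 : 0 < p.toReal := zero_lt_one.trans_le (one_le_toReal_of_one_le hp1 hp)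
  set τ : ℝ := n / p.toReal with hτ
  have hτ2 : τ < 2 := (div_lt_iff₀ hq0).2 hnp
  have h1σ : 0 < 1 - (τ - 1) := by linarith
  let W : (RSpace n → ℂ) → ℝ := fun w => (eLpNorm w (ENNReal.conjExponent p) volume).toReal
  have hW : ∀ w, 0 ≤ W w := fun w => ENNReal.toReal_nonneg
  let w₁ : Fin n → RSpace n → ℂ := fun i y => (y i : ℂ) * w y
  let w₂ : Fin n → Fin n → RSpace n → ℂ := fun i j y => (y j : ℂ) * w₁ i y
  have hw₁ : ∀ i, Continuous (w₁ i) ∧ HasCompactSupport (w₁ i) := continuousCompact_coord_mul hw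
  have hw₂ : ∀ i j, Continuous (w₂ i j) ∧ HasCompactSupport (w₂ i j) := fun i =>
    continuousCompact_coord_mul (hw₁ i)
  let S₁ : ℝ := ∑ i, W (w₁ i)
  let S₂ : ℝ := ∑ i, ∑ j, W (w₂ i j)
  have hS₁ : 0 ≤ S₁ := Finset.sum_nonneg fun i _ => hW _
  have hS₂ : 0 ≤ S₂ := Finset.sum_nonneg fun i _ => Finset.sum_nonneg fun j _ => hW _
  refine ⟨W w + S₁ + S₂ / (1 - (τ - 1)), add_nonneg (add_nonneg (hW w) hS₁)
    (div_nonneg hS₂ h1σ.le), fun φ M hφ hM0 hM1 hM2 x => ?_⟩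
  have hM : 0 ≤ M := ENNReal.toReal_nonneg.trans hM0
  let a : ℝ → ℂ := scaledAverage φ w x
  let a₁ : ℝ → ℂ := fun t => ∑ i, scaledAverage (partialDeriv i φ) (w₁ i) x t
  let a₂ : ℝ → ℂ := fun t => ∑ i, ∑ j,
    scaledAverage (partialDeriv j (partialDeriv i φ)) (w₂ i j) x t
  have hφ1 := fun i => smoothCompact_partialDeriv i hφ
  have hφ2 := fun i j => smoothCompact_partialDeriv j (hφ1 i)
  have ha : ∀ t, HasDerivAt a (a₁ t) t := hasDerivAt_scaledAverage hφ hw x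
  have ha₁ : ∀ t, HasDerivAt a₁ (a₂ t) t := fun t =>
    HasDerivAt.fun_sum fun i _ => hasDerivAt_scaledAverage (hφ1 i) (hw₁ i) x t
  -- Subtracting `t a'` keeps the value `φ x` at `t = 0` and leaves the derivative `-t a''`, of size
  -- `t^{1-n/p}`. The extra factor `t` relaxes the requirement from `n / p < 1` to `n / p < 2`.
  have hb : ∀ t, HasDerivAt (fun t : ℝ => a t - t * a₁ t) (-(t * a₂ t)) t := by
    intro t
    have h1 := (ha t).sub ((Complex.ofRealCLM.hasDerivAt (x := t)).mul (ha₁ t))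
    refine h1.congr_deriv ?_
    simp
  have h := norm_le_of_norm_deriv_le_rpow hb (K := S₂ * M) (σ := τ - 1)
    (mul_nonneg hS₂ hM) (by linarith) fun t ht _ => ?_
  · simp only [Complex.ofReal_zero, zero_mul, sub_zero, Complex.ofReal_one, one_mul] at h
    rw [show a 0 = φ x from scaledAverage_zero hw1 x] at h
    have h1 : ‖a 1‖ ≤ W w * M := by
      have h1 := norm_scaledAverage_le hp1 hp hφ hw x one_pos
      rw [Real.one_rpow, mul_one] at h1
      exact h1.trans (mul_le_mul_of_nonneg_left hM0 ENNReal.toReal_nonneg)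
    have h2 : ‖a₁ 1‖ ≤ S₁ * M := by
      refine (norm_sum_le _ _).trans ?_
      simp only [S₁, Finset.sum_mul]
      refine Finset.sum_le_sum fun i _ => ?_
      have h1 := norm_scaledAverage_le hp1 hp (hφ1 i) (hw₁ i) x one_pos
      rw [Real.one_rpow, mul_one] at h1
      exact h1.trans (mul_le_mul_of_nonneg_left (hM1 i) ENNReal.toReal_nonneg)
    calc ‖φ x‖ ≤ ‖a 1 - a₁ 1‖ + S₂ * M / (1 - (τ - 1)) := h
      _ ≤ ‖a 1‖ + ‖a₁ 1‖ + S₂ * M / (1 - (τ - 1)) := by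
        gcongr
        exact norm_sub_le _ _
      _ ≤ W w * M + S₁ * M + S₂ * M / (1 - (τ - 1)) := by gcongr
      _ = _ := by ring
  · have h2 : ‖a₂ t‖ ≤ S₂ * M * t ^ (-τ) := by
      refine (norm_sum_le _ _).trans ?_
      simp only [S₂, Finset.sum_mul]
      refine Finset.sum_le_sum fun i _ => (norm_sum_le _ _).trans ?_
      refine Finset.sum_le_sum fun j _ => ?_
      refine (norm_scaledAverage_le hp1 hp (hφ2 i j) (hw₂ i j) x ht).trans ?_
      gcongr
      exact hM2 i j
    rw [norm_neg, norm_mul, Complex.norm_real, Real.norm_of_nonneg ht.le]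
    calc t * ‖a₂ t‖ ≤ t * (S₂ * M * t ^ (-τ)) := by gcongr
      _ = S₂ * M * (t ^ (1 : ℝ) * t ^ (-τ)) := by rw [Real.rpow_one]; ring
      _ = S₂ * M * t ^ (-(τ - 1)) := by
        rw [← Real.rpow_add ht]
        ring_nf

end SobolevEmbedding

/-! ### Continuous and `C¹` representatives; correction at the origin -/

section Representatives

open Filter Topology

namespace SobolevSpace

variable {n k : ℕ} {p : ℝ≥0∞} [Fact (1 ≤ p)]

theorem exists_seq_ofSmooth_tendsto {U Ω : Opens (RSpace n)} {f : SobolevSpace n k p Ω}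
    (hf : f ∈ closure (testFunctions k p U Ω)) :
    ∃ (φ : ℕ → RSpace n → ℂ) (hφ : ∀ j, IsTestFun U (φ j)),
      Tendsto (fun j => ofSmooth n k p Ω ⟨(hφ j).1, (hφ j).2⟩) atTop (𝓝 f) := by
  rw [mem_closure_iff_seq_limit, testFunctions_eq] at hf
  obtain ⟨u, hu, hlim⟩ := hf
  choose φ hφ hu using hu
  exact ⟨φ, hφ, hlim.congr hu⟩

theorem ofSmooth_ae_eq_top {φ : RSpace n → ℂ} (h : ContDiff ℝ ∞ φ ∧ HasCompactSupport φ) :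
    toLp (ofSmooth n k p ⊤ h) =ᵐ[volume] φ :=
  ae_eq_restrict_top_iff.1 (ofSmooth_ae_eq h)

theorem ofSmooth_sub_sum {ι : Type*} (s : Finset ι) (c : ι → ℂ) {φ : RSpace n → ℂ}
    {ψ : ι → RSpace n → ℂ} (hφ : ContDiff ℝ ∞ φ ∧ HasCompactSupport φ)
    (hψ : ∀ a, ContDiff ℝ ∞ (ψ a) ∧ HasCompactSupport (ψ a))
    (h : ContDiff ℝ ∞ (fun x => φ x - ∑ a ∈ s, c a * ψ a x) ∧
      HasCompactSupport (fun x => φ x - ∑ a ∈ s, c a * ψ a x)) :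
    ofSmooth n k p ⊤ h =
      ofSmooth n k p ⊤ hφ - ∑ a ∈ s, c a • ofSmooth n k p ⊤ (hψ a) := by
  refine ext_ae ?_
  have hsum : ∀ s : Finset ι, toLp (∑ a ∈ s, c a • ofSmooth n k p ⊤ (hψ a))
      =ᵐ[volume.restrict ((⊤ : Opens (RSpace n)) : Set (RSpace n))]
        fun x => ∑ a ∈ s, c a * ψ a x := by
    classical
    intro s
    induction s using Finset.induction_on with
    | empty =>
      rw [Finset.sum_empty, map_zero]
      exact (Lp.coeFn_zero _ _ _).trans (.of_forall fun x => by simp)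
    | insert a s ha ih =>
      rw [Finset.sum_insert ha, map_add, map_smul]
      filter_upwards [ih, Lp.coeFn_add (c a • toLp (ofSmooth n k p ⊤ (hψ a)))
        (toLp (∑ a ∈ s, c a • ofSmooth n k p ⊤ (hψ a))),
        Lp.coeFn_smul (c a) (toLp (ofSmooth n k p ⊤ (hψ a))), ofSmooth_ae_eq (k := k) (p := p) (hψ a)]
        with x h1 h2 h3 h4
      rw [h2, Pi.add_apply, h1, h3, Pi.smul_apply, h4, Finset.sum_insert ha, smul_eq_mul]
  rw [map_sub]
  filter_upwards [hsum s, ofSmooth_ae_eq (k := k) (p := p) h, ofSmooth_ae_eq (k := k) (p := p) hφ,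
    Lp.coeFn_sub (toLp (ofSmooth n k p ⊤ hφ))
      (toLp (∑ a ∈ s, c a • ofSmooth n k p ⊤ (hψ a)))] with x h1 h2 h3 h4
  rw [h2, h4, Pi.sub_apply, h1, h3]

theorem eLpNorm_multiDeriv_le_norm {φ : RSpace n → ℂ}
    (hφ : ContDiff ℝ ∞ φ ∧ HasCompactSupport φ) (α : MultiIdx n k) :
    (eLpNorm (multiDeriv α.1 φ) p volume).toReal ≤ ‖ofSmooth n k p ⊤ hφ‖ := by
  refine le_trans (le_of_eq ?_) (norm_weakDeriv_le α _)
  rw [Lp.norm_def, eLpNorm_congr_ae (weakDeriv_ofSmooth_ae_eq hφ α), eLpNorm_restrict_top]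

theorem eLpNorm_le_norm {φ : RSpace n → ℂ} (hφ : ContDiff ℝ ∞ φ ∧ HasCompactSupport φ) :
    (eLpNorm φ p volume).toReal ≤ ‖ofSmooth n 2 p ⊤ hφ‖ := by
  have := eLpNorm_multiDeriv_le_norm (p := p) hφ (zeroIdx n 2)
  rwa [zeroIdx, multiDeriv_zero] at this

theorem eLpNorm_partialDeriv_le_norm {φ : RSpace n → ℂ}
    (hφ : ContDiff ℝ ∞ φ ∧ HasCompactSupport φ) (i : Fin n) :
    (eLpNorm (partialDeriv i φ) p volume).toReal ≤ ‖ofSmooth n 2 p ⊤ hφ‖ := by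
  have := eLpNorm_multiDeriv_le_norm (p := p) (k := 2) hφ
    ⟨Pi.single i 1, (mem_multiIdx_iff _).2 (by simp)⟩
  rwa [multiDeriv_single hφ.1] at this

theorem eLpNorm_partialDeriv_partialDeriv_le_norm {φ : RSpace n → ℂ}
    (hφ : ContDiff ℝ ∞ φ ∧ HasCompactSupport φ) (i j : Fin n) :
    (eLpNorm (partialDeriv j (partialDeriv i φ)) p volume).toReal ≤ ‖ofSmooth n 2 p ⊤ hφ‖ := by
  have := eLpNorm_multiDeriv_le_norm (p := p) (k := 2) hφ
    ⟨Pi.single i 1 + Pi.single j 1, (mem_multiIdx_iff _).2 (by simp [Finset.sum_add_distrib])⟩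
  rwa [multiDeriv_add_single hφ.1, multiDeriv_single hφ.1] at this

theorem exists_bound_norm (hp : p ≠ ⊤) (hnp : (n : ℝ) < 2 * p.toReal) :
    ∃ C : ℝ, ∀ (φ : RSpace n → ℂ) (hφ : ContDiff ℝ ∞ φ ∧ HasCompactSupport φ) x,
      ‖φ x‖ ≤ C * ‖ofSmooth n 2 p ⊤ hφ‖ := by
  obtain ⟨C, -, hC⟩ := exists_sobolev_bound_two (n := n) Fact.out hp hnp
  exact ⟨C, fun φ hφ x => hC φ _ hφ (eLpNorm_le_norm hφ) (eLpNorm_partialDeriv_le_norm hφ)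
    (eLpNorm_partialDeriv_partialDeriv_le_norm hφ) x⟩

theorem exists_bound_norm_fderiv (hp : p ≠ ⊤) (hnp : (n : ℝ) < p.toReal) :
    ∃ C : ℝ, ∀ (φ : RSpace n → ℂ) (hφ : ContDiff ℝ ∞ φ ∧ HasCompactSupport φ) x,
      ‖fderiv ℝ φ x‖ ≤ C * ‖ofSmooth n 2 p ⊤ hφ‖ := by
  obtain ⟨C, -, hC⟩ := exists_sobolev_bound_one (n := n) Fact.out hp hnp
  refine ⟨n * C, fun φ hφ x => ?_⟩
  have h : ‖iteratedFDeriv ℝ 1 φ x‖ ≤ _ := norm_iteratedFDeriv_succ_le_sum hφ.1 0 x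
  simp only [norm_iteratedFDeriv_one, norm_iteratedFDeriv_zero] at h
  refine h.trans ((Finset.sum_le_sum fun i _ => hC (partialDeriv i φ) _
    (smoothCompact_partialDeriv i hφ) (eLpNorm_partialDeriv_le_norm hφ i)
    (eLpNorm_partialDeriv_partialDeriv_le_norm hφ i) x).trans_eq ?_)
  simp [mul_assoc]

theorem ofSmooth_sub {φ ψ : RSpace n → ℂ} (hφ : ContDiff ℝ ∞ φ ∧ HasCompactSupport φ)
    (hψ : ContDiff ℝ ∞ ψ ∧ HasCompactSupport ψ)
    (h : ContDiff ℝ ∞ (fun x => φ x - ψ x) ∧ HasCompactSupport (fun x => φ x - ψ x)) :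
    ofSmooth n k p ⊤ h = ofSmooth n k p ⊤ hφ - ofSmooth n k p ⊤ hψ := by
  refine ext_ae ?_
  rw [map_sub]
  filter_upwards [ofSmooth_ae_eq (k := k) (p := p) h, ofSmooth_ae_eq (k := k) (p := p) hφ,
    ofSmooth_ae_eq (k := k) (p := p) hψ,
    Lp.coeFn_sub (toLp (ofSmooth n k p ⊤ hφ)) (toLp (ofSmooth n k p ⊤ hψ))] with x h1 h2 h3 h4
  rw [h1, h4, Pi.sub_apply, h2, h3]

/-- Used for the approximants themselves and for their Fréchet derivatives, with the Sobolev
inequality applied to differences. -/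
theorem exists_tendstoUniformly_of_norm_sub_le {X F V : Type*} [NormedAddCommGroup F]
    [CompleteSpace F] [NormedAddCommGroup V] {u : ℕ → X → F} {v : ℕ → V} (hv : CauchySeq v)
    {C : ℝ} (h : ∀ i j x, ‖u i x - u j x‖ ≤ C * ‖v i - v j‖) :
    ∃ g : X → F, TendstoUniformly u g atTop := by
  have hu : UniformCauchySeqOn u atTop univ := by
    rw [Metric.uniformCauchySeqOn_iff]
    intro ε hε
    obtain ⟨N, hN⟩ := Metric.cauchySeq_iff.1 hv (ε / (|C| + 1)) (by positivity)
    refine ⟨N, fun i hi j hj x _ => ?_⟩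
    have h1 := hN i hi j hj
    rw [dist_eq_norm] at h1 ⊢
    calc ‖u i x - u j x‖ ≤ C * ‖v i - v j‖ := h i j x
      _ ≤ (|C| + 1) * ‖v i - v j‖ := by
        gcongr
        linarith [le_abs_self C]
      _ < (|C| + 1) * (ε / (|C| + 1)) := by gcongr
      _ = ε := by field_simp
  choose g hg using fun x => cauchySeq_tendsto_of_complete (hu.cauchySeq (mem_univ x))
  exact ⟨g, tendstoUniformlyOn_univ.1 (hu.tendstoUniformlyOn_of_tendsto fun x _ => hg x)⟩

/-- A sequence of test functions converging in `W^{2,p}`, `p > n / 2`, converges uniformly to a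
continuous representative of the limit. -/
theorem exists_continuous_representative (hp : p ≠ ⊤) (hnp : (n : ℝ) < 2 * p.toReal)
    {f : SobolevSpace n 2 p (⊤ : Opens (RSpace n))} {φ : ℕ → RSpace n → ℂ}
    (hφ : ∀ j, ContDiff ℝ ∞ (φ j) ∧ HasCompactSupport (φ j))
    (hlim : Tendsto (fun j => ofSmooth n 2 p ⊤ (hφ j)) atTop (𝓝 f)) :
    ∃ g : RSpace n → ℂ, Continuous g ∧ f =ᵐ[volume] g ∧
      ∀ x, Tendsto (fun j => φ j x) atTop (𝓝 (g x)) := by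
  have hp1 : 1 ≤ p := Fact.out
  obtain ⟨C, hC⟩ := exists_bound_norm hp hnp
  obtain ⟨g, hg⟩ := exists_tendstoUniformly_of_norm_sub_le hlim.cauchySeq (u := φ) (C := C)
    fun i j x => by
      have hs : ContDiff ℝ ∞ (fun x => φ i x - φ j x) ∧
          HasCompactSupport (fun x => φ i x - φ j x) :=
        ⟨(hφ i).1.sub (hφ j).1, (hφ i).2.sub (hφ j).2⟩
      have := hC _ hs x
      rwa [ofSmooth_sub (hφ i) (hφ j) hs] at this
  have hpt : ∀ x, Tendsto (fun j => φ j x) atTop (𝓝 (g x)) := fun x => hg.tendsto_at x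
  refine ⟨g, hg.continuous (.of_forall fun j => (hφ j).1.continuous), ?_, hpt⟩
  have h0 := tendsto_iff.1 hlim (zeroIdx n 2)
  simp only [weakDeriv_zeroIdx, eLpNorm_restrict_top] at h0
  have h1 : Tendsto (fun j => eLpNorm (φ j - ⇑(toLp f)) p volume) atTop (𝓝 0) := by
    refine h0.congr fun j => eLpNorm_congr_ae ?_
    filter_upwards [ofSmooth_ae_eq_top (k := 2) (p := p) (hφ j)] with x hx
    rw [hx, Pi.sub_apply]
  -- `L^p` convergence gives a subsequence converging almost everywhere to `f`, which identifies the
  -- uniform limit.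
  have h2 := tendstoInMeasure_of_tendsto_eLpNorm (zero_lt_one.trans_le hp1).ne'
    (fun j => (hφ j).1.continuous.aestronglyMeasurable) (memLp_coe_top (toLp f)).1 h1
  obtain ⟨ns, hns, hae⟩ := h2.exists_seq_tendsto_ae
  filter_upwards [hae] with x hx
  exact tendsto_nhds_unique hx ((hpt x).comp hns.tendsto_atTop)

/-- A sequence of test functions converging in `W^{2,p}`, `p > n`, converges in `C¹` to a
representative of the limit. -/
theorem exists_contDiff_representative (hp : p ≠ ⊤) (hnp : (n : ℝ) < p.toReal)
    {f : SobolevSpace n 2 p (⊤ : Opens (RSpace n))} {φ : ℕ → RSpace n → ℂ}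
    (hφ : ∀ j, ContDiff ℝ ∞ (φ j) ∧ HasCompactSupport (φ j))
    (hlim : Tendsto (fun j => ofSmooth n 2 p ⊤ (hφ j)) atTop (𝓝 f)) :
    ∃ g : RSpace n → ℂ, ContDiff ℝ 1 g ∧ f =ᵐ[volume] g ∧
      (∀ x, Tendsto (fun j => φ j x) atTop (𝓝 (g x))) ∧
      ∀ i x, Tendsto (fun j => partialDeriv i (φ j) x) atTop (𝓝 (partialDeriv i g x)) := by
  have hq0 : 0 ≤ p.toReal := ENNReal.toReal_nonneg
  obtain ⟨g, hgc, hfg, hpt⟩ := exists_continuous_representative hp (by linarith) hφ hlim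
  obtain ⟨C, hC⟩ := exists_bound_norm_fderiv (n := n) hp hnp
  have hd : ∀ j, Differentiable ℝ (φ j) := fun j => (hφ j).1.differentiable (by simp)
  obtain ⟨G, hG⟩ := exists_tendstoUniformly_of_norm_sub_le hlim.cauchySeq
    (u := fun j => fderiv ℝ (φ j)) (C := C) fun i j x => by
      have hs : ContDiff ℝ ∞ (fun x => φ i x - φ j x) ∧
          HasCompactSupport (fun x => φ i x - φ j x) :=
        ⟨(hφ i).1.sub (hφ j).1, (hφ i).2.sub (hφ j).2⟩
      have := hC _ hs x
      rwa [ofSmooth_sub (hφ i) (hφ j) hs, fderiv_fun_sub (hd i x) (hd j x)] at this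
  have hgd : ∀ x, HasFDerivAt g (G x) x := hasFDerivAt_of_tendstoUniformly hG
    (fun j x => (hd j x).hasFDerivAt) hpt
  have hfd : fderiv ℝ g = G := funext fun x => (hgd x).fderiv
  refine ⟨g, contDiff_one_iff_fderiv.2 ⟨fun x => (hgd x).differentiableAt, ?_⟩, hfg, hpt,
    fun i x => ?_⟩
  · rw [hfd]
    exact hG.continuous (.of_forall fun j => (hφ j).1.continuous_fderiv (by simp))
  · have h1 := hG.tendsto_at x
    simp only [partialDeriv, hfd]
    exact ((ContinuousLinearMap.apply ℝ ℂ (EuclideanSpace.single i (1 : ℝ))).continuous.tendsto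
      _).comp h1

/-- Correction of an approximating sequence by finitely many functions with coefficients tending
to zero. -/
theorem mem_closure_of_correction {U : Opens (RSpace n)} {ι : Type*} [Fintype ι]
    {f : SobolevSpace n k p (⊤ : Opens (RSpace n))} {φ : ℕ → RSpace n → ℂ}
    (hφ : ∀ j, ContDiff ℝ ∞ (φ j) ∧ HasCompactSupport (φ j))
    (hlim : Tendsto (fun j => ofSmooth n k p ⊤ (hφ j)) atTop (𝓝 f))
    {ψ : ι → RSpace n → ℂ} (hψ : ∀ a, ContDiff ℝ ∞ (ψ a) ∧ HasCompactSupport (ψ a))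
    {c : ℕ → ι → ℂ} (hc : ∀ a, Tendsto (fun j => c j a) atTop (𝓝 0))
    (hmem : ∀ j (h : ContDiff ℝ ∞ (fun x => φ j x - ∑ a, c j a * ψ a x) ∧
      HasCompactSupport (fun x => φ j x - ∑ a, c j a * ψ a x)),
        ofSmooth n k p ⊤ h ∈ closure (testFunctions k p U ⊤)) :
    f ∈ closure (testFunctions k p U ⊤) := by
  have hs : ∀ j, ContDiff ℝ ∞ (fun x => φ j x - ∑ a, c j a * ψ a x) ∧
      HasCompactSupport (fun x => φ j x - ∑ a, c j a * ψ a x) := by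
    intro j
    refine ⟨(hφ j).1.sub (ContDiff.sum fun a _ => contDiff_const.mul (hψ a).1), ?_⟩
    refine (hφ j).2.sub ?_
    have : (fun x => ∑ a, c j a * ψ a x) = ∑ a, fun x => c j a * ψ a x := by
      funext x
      simp
    rw [this]
    exact Finset.sum_induction _ HasCompactSupport (fun _ _ h1 h2 => h1.add h2)
      HasCompactSupport.zero fun a _ => (hψ a).2.mul_left
  have h1 : Tendsto (fun j => ofSmooth n k p ⊤ (hφ j) -
      ∑ a, c j a • ofSmooth n k p ⊤ (hψ a)) atTop (𝓝 f) := by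
    have h2 := hlim.sub (tendsto_finsetSum Finset.univ fun a _ =>
      (hc a).smul_const (ofSmooth n k p ⊤ (hψ a)))
    simpa using h2
  refine isClosed_closure.mem_of_tendsto h1 (.of_forall fun j => ?_)
  rw [← ofSmooth_sub_sum Finset.univ (c j) (hφ j) hψ (hs j)]
  exact hmem j (hs j)

end SobolevSpace

/-- Taylor bounds: a smooth compactly supported function whose derivatives of order `< m` vanish
at the origin. -/
theorem exists_bound_of_vanishing {n : ℕ} {φ : RSpace n → ℂ}
    (hφ : ContDiff ℝ ∞ φ ∧ HasCompactSupport φ) {m : ℕ} (hm : m ≤ 2)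
    (h0 : ∀ i < m, iteratedFDeriv ℝ i φ 0 = 0) :
    ∃ C : ℝ, ∀ i ≤ 2, ∀ x, ‖iteratedFDeriv ℝ i φ x‖ ≤ C * ‖x‖ ^ (m - i) := by
  obtain ⟨C, hC0, hC⟩ := exists_bound_iteratedFDeriv hφ 2
  refine ⟨C, fun i hi => ?_⟩
  -- Mean value inequality on the ball of radius `‖x‖`: vanishing at `0` gains one power of `‖x‖`
  -- over the next derivative.
  have step : ∀ i e, iteratedFDeriv ℝ i φ 0 = 0 →
      (∀ x, ‖iteratedFDeriv ℝ (i + 1) φ x‖ ≤ C * ‖x‖ ^ e) →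
      ∀ x, ‖iteratedFDeriv ℝ i φ x‖ ≤ C * ‖x‖ ^ (e + 1) := by
    intro i e hi0 hle x
    have hd : Differentiable ℝ (iteratedFDeriv ℝ i φ) :=
      hφ.1.differentiable_iteratedFDeriv (by exact_mod_cast WithTop.coe_lt_top _)
    have h := Convex.norm_image_sub_le_of_norm_fderiv_le (𝕜 := ℝ) (f := iteratedFDeriv ℝ i φ)
      (C := C * ‖x‖ ^ e) (s := Metric.closedBall 0 ‖x‖) (x := 0) (y := x)
      (fun y _ => hd y) (fun y hy => ?_) (convex_closedBall 0 ‖x‖)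
      (Metric.mem_closedBall_self (norm_nonneg x)) (by simp)
    · rw [hi0, sub_zero, sub_zero] at h
      rw [pow_succ, ← mul_assoc]
      exact h
    · rw [norm_fderiv_iteratedFDeriv]
      refine (hle y).trans ?_
      gcongr
      exact mem_closedBall_zero_iff.1 hy
  have base : ∀ i ≤ 2, m ≤ i → ∀ x, ‖iteratedFDeriv ℝ i φ x‖ ≤ C * ‖x‖ ^ (m - i) := by
    intro i hi hmi x
    rw [Nat.sub_eq_zero_of_le hmi, pow_zero, mul_one]
    exact hC i hi x
  -- Descent from order `m`, where the derivative is merely bounded, to order `m - d`.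
  have down : ∀ d, ∀ i, i + d = m → ∀ x, ‖iteratedFDeriv ℝ i φ x‖ ≤ C * ‖x‖ ^ d := by
    intro d
    induction d with
    | zero =>
      intro i hid x
      have h1 := base i (by omega) (by omega) x
      rwa [show m - i = 0 by omega] at h1
    | succ d ih =>
      intro i hid
      exact step i d (h0 i (by omega)) (ih (i + 1) (by omega))
  rcases le_or_gt m i with h | h
  · exact base i hi h
  · exact down (m - i) i (by omega)

end Representatives

/-! ### The closure of `C₀^∞(ℝⁿ ∖ {0})` in the three ranges of `p` -/

section ClosureOfPuncturedTestFunctions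

open Filter Topology

namespace SobolevSpace

variable {n : ℕ} {p : ℝ≥0∞} [Fact (1 ≤ p)]

/-- The case `m = 0`, `s = 2`: no vanishing is needed, so every test function is approximable, and
density finishes. -/
theorem closure_testFunctions_punctured_eq_univ (hn : 1 ≤ n) (hp1 : 1 < p) (hp : p ≠ ⊤)
    (hnp : 2 * p.toReal ≤ n) : closure (testFunctions 2 p (punctured n) ⊤) = univ := by
  refine eq_univ_of_forall fun f => ?_
  refine closure_minimal ?_ isClosed_closure (dense_testFunctions_top hp f)
  rw [testFunctions_eq]
  rintro _ ⟨φ, hφ, rfl⟩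
  have hs : ContDiff ℝ ∞ φ ∧ HasCompactSupport φ := ⟨hφ.1, hφ.2⟩
  obtain ⟨C, hC⟩ := exists_bound_of_vanishing hs (m := 0) (by omega) (by omega)
  exact ofSmooth_mem_closure_punctured hn hp1 hp (s := 2) le_rfl (by omega)
    (by exact_mod_cast hnp) hs hC

theorem existsUnique_continuous_representative (hp : p ≠ ⊤) (hnp : (n : ℝ) < 2 * p.toReal)
    (f : SobolevSpace n 2 p (⊤ : Opens (RSpace n))) :
    ∃! g : RSpace n → ℂ, Continuous g ∧ f =ᵐ[volume] g := by
  obtain ⟨φ, hφ, hlim⟩ := exists_seq_ofSmooth_tendsto (dense_testFunctions_top hp f)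
  obtain ⟨g, hg, hfg, -⟩ := exists_continuous_representative hp hnp _ hlim
  exact ⟨g, ⟨hg, hfg⟩, fun g' h' =>
    (Continuous.ae_eq_iff_eq volume h'.1 hg).1 (h'.2.symm.trans hfg)⟩

theorem existsUnique_contDiff_representative (hp : p ≠ ⊤) (hnp : (n : ℝ) < p.toReal)
    (f : SobolevSpace n 2 p (⊤ : Opens (RSpace n))) :
    ∃! g : RSpace n → ℂ, ContDiff ℝ 1 g ∧ f =ᵐ[volume] g := by
  obtain ⟨φ, hφ, hlim⟩ := exists_seq_ofSmooth_tendsto (dense_testFunctions_top hp f)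
  obtain ⟨g, hg, hfg, -⟩ := exists_contDiff_representative hp hnp _ hlim
  exact ⟨g, ⟨hg, hfg⟩, fun g' h' =>
    (Continuous.ae_eq_iff_eq volume h'.1.continuous hg.continuous).1 (h'.2.symm.trans hfg)⟩

theorem eventuallyEq_zero_of_isTestFun_punctured {φ : RSpace n → ℂ}
    (hφ : IsTestFun (punctured n) φ) : φ =ᶠ[𝓝 0] 0 :=
  notMem_tsupport_iff_eventuallyEq.1 fun h => hφ.3 h rfl

/-- The case `m = s = 1`. Evaluation at `0` passes to the limit since `n < 2p`; conversely `φ_j -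
φ_j(0) χ` vanishes at `0`, and `p ≤ n` is the condition for cutting it off. -/
theorem closure_testFunctions_punctured_eq_vanishingAtZero (hn : 1 ≤ n) (hp1 : 1 < p)
    (hp : p ≠ ⊤) (hnp : (n : ℝ) < 2 * p.toReal) (hpn : p.toReal ≤ n) :
    closure (testFunctions 2 p (punctured n) ⊤) = vanishingAtZero n p := by
  ext f
  constructor
  · intro hf
    obtain ⟨φ, hφ, hlim⟩ := exists_seq_ofSmooth_tendsto hf
    obtain ⟨g, hg, hfg, hpt⟩ := exists_continuous_representative hp hnp _ hlim
    refine ⟨g, hg, hfg, tendsto_nhds_unique (hpt 0) (tendsto_const_nhds.congr fun j => ?_)⟩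
    exact (eventuallyEq_zero_of_isTestFun_punctured (hφ j)).eq_of_nhds.symm
  · rintro ⟨g, hg, hfg, hg0⟩
    obtain ⟨φ, hφ, hlim⟩ := exists_seq_ofSmooth_tendsto (dense_testFunctions_top hp f)
    obtain ⟨g', hg', hfg', hpt⟩ := exists_continuous_representative hp hnp _ hlim
    have hgg : g' = g := (Continuous.ae_eq_iff_eq volume hg' hg).1 (hfg'.symm.trans hfg)
    have h0 : Tendsto (fun j => φ j 0) atTop (𝓝 0) := by
      have := hpt 0
      rwa [hgg, hg0] at this
    obtain ⟨χ, hχ, hχ1, -⟩ := exists_cutoff n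
    refine mem_closure_of_correction (ι := Unit) _ hlim (ψ := fun _ => χ) (fun _ => hχ)
      (c := fun j _ => φ j 0) (fun _ => h0) fun j h => ?_
    obtain ⟨C, hC⟩ := exists_bound_of_vanishing h (m := 1) (by omega) (by
      intro i hi
      interval_cases i
      rw [← norm_eq_zero, norm_iteratedFDeriv_zero]
      simp [hχ1 0 (by simp)])
    exact ofSmooth_mem_closure_punctured hn hp1 hp (s := 1) le_rfl (by omega)
      (by simpa using hpn) h hC

/-- The case `m = 2`, `s = 0`, where the cutoff condition `s p ≤ n` is void; `n < p` serves only to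
make the first-order Taylor data at `0` continuous. -/
theorem closure_testFunctions_punctured_eq_vanishingToFirstOrderAtZero (hn : 1 ≤ n)
    (hp1 : 1 < p) (hp : p ≠ ⊤) (hnp : (n : ℝ) < p.toReal) :
    closure (testFunctions 2 p (punctured n) ⊤) = vanishingToFirstOrderAtZero n p := by
  ext f
  constructor
  · intro hf
    obtain ⟨φ, hφ, hlim⟩ := exists_seq_ofSmooth_tendsto hf
    obtain ⟨g, hg, hfg, hpt, hptd⟩ := exists_contDiff_representative hp hnp _ hlim
    refine ⟨g, hg, hfg, tendsto_nhds_unique (hpt 0) (tendsto_const_nhds.congr fun j => ?_),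
      fun i => tendsto_nhds_unique (hptd i 0) (tendsto_const_nhds.congr fun j => ?_)⟩
    · exact (eventuallyEq_zero_of_isTestFun_punctured (hφ j)).eq_of_nhds.symm
    · rw [partialDeriv, (eventuallyEq_zero_of_isTestFun_punctured (hφ j)).fderiv_eq]
      simp
  · rintro ⟨g, hg, hfg, hg0, hgd⟩
    obtain ⟨φ, hφ, hlim⟩ := exists_seq_ofSmooth_tendsto (dense_testFunctions_top hp f)
    obtain ⟨g', hg', hfg', hpt, hptd⟩ := exists_contDiff_representative hp hnp _ hlim
    have hgg : g' = g := (Continuous.ae_eq_iff_eq volume hg'.continuous hg.continuous).1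
      (hfg'.symm.trans hfg)
    have h0 : Tendsto (fun j => φ j 0) atTop (𝓝 0) := by
      have := hpt 0
      rwa [hgg, hg0] at this
    have h1 : ∀ i, Tendsto (fun j => partialDeriv i (φ j) 0) atTop (𝓝 0) := by
      intro i
      have := hptd i 0
      rwa [hgg, hgd i] at this
    obtain ⟨χ, hχ, hχ1, -⟩ := exists_cutoff n
    -- The correctors are `χ`, at index `none`, for the value and `x_i χ` for the partial
    -- derivatives.
    refine mem_closure_of_correction (ι := Option (Fin n)) _ hlim
      (ψ := fun a => a.elim χ fun i x => (x i : ℂ) * χ x) (fun a => ?_)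
      (c := fun j a => a.elim (φ j 0) fun i => partialDeriv i (φ j) 0) (fun a => ?_) fun j h => ?_
    · cases a with
      | none => exact hχ
      | some i =>
        refine ⟨ContDiff.mul ?_ hχ.1, hχ.2.mul_left⟩
        exact Complex.ofRealCLM.contDiff.comp (contDiff_piLp_apply (i := i) (p := 2))
    · cases a with
      | none => exact h0
      | some i => exact h1 i
    · have hloc : (fun x => φ j x - ∑ a : Option (Fin n),
          (a.elim (φ j 0) fun i => partialDeriv i (φ j) 0 : ℂ) *
            (a.elim χ fun i x => (x i : ℂ) * χ x : RSpace n → ℂ) x) =ᶠ[𝓝 0]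
          fun x => φ j x - (φ j 0 + fderiv ℝ (φ j) 0 x) := by
        filter_upwards [Metric.ball_mem_nhds (0 : RSpace n) one_pos] with x hx
        have : χ x = 1 := hχ1 x (mem_ball_zero_iff.1 hx).le
        simp only [Fintype.sum_option, Option.elim, this, mul_one, fderiv_apply_eq_sum]
        simp only [mul_comm]
      have hd : HasFDerivAt (fun x => φ j x - (φ j 0 + fderiv ℝ (φ j) 0 x))
          (fderiv ℝ (φ j) 0 - fderiv ℝ (φ j) 0) 0 :=
        ((hφ j).1.differentiable (by simp) 0).hasFDerivAt.sub
          ((fderiv ℝ (φ j) 0).hasFDerivAt.const_add _)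
      obtain ⟨C, hC⟩ := exists_bound_of_vanishing h (m := 2) le_rfl (by
        intro i hi
        interval_cases i
        · rw [← norm_eq_zero, norm_iteratedFDeriv_zero, hloc.eq_of_nhds]
          simp
        · rw [← norm_eq_zero, norm_iteratedFDeriv_one, hloc.fderiv_eq, hd.fderiv, sub_self,
            norm_zero])
      exact ofSmooth_mem_closure_punctured hn hp1 hp (s := 0) le_rfl le_rfl (by simp) h hC

end SobolevSpace

end ClosureOfPuncturedTestFunctions

end

/-! ### The three cases assembled -/

theorem proposition6p3 (n : ℕ) (hn : 1 ≤ n) (p : ℝ≥0∞) [Fact (1 ≤ p)]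
    (hp1 : 1 < p) (hp : p ≠ ⊤) :
    (p ≤ (n : ℝ≥0∞) / 2 →
      closure (testFunctions 2 p (punctured n) ⊤) = Set.univ ∧
      sobolevZero 2 p (punctured n) = restrictions (punctured n) Set.univ) ∧
    ((n : ℝ≥0∞) / 2 < p → p ≤ (n : ℝ≥0∞) →
      (∀ f : SobolevSpace n 2 p ⊤, ∃! g : RSpace n → ℂ, Continuous g ∧ f =ᵐ[volume] g) ∧
      closure (testFunctions 2 p (punctured n) ⊤) = vanishingAtZero n p ∧
      sobolevZero 2 p (punctured n) = restrictions (punctured n) (vanishingAtZero n p)) ∧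
    ((n : ℝ≥0∞) < p →
      (∀ f : SobolevSpace n 2 p ⊤, ∃! g : RSpace n → ℂ, ContDiff ℝ 1 g ∧ f =ᵐ[volume] g) ∧
      closure (testFunctions 2 p (punctured n) ⊤) = vanishingToFirstOrderAtZero n p ∧
      sobolevZero 2 p (punctured n) =
        restrictions (punctured n) (vanishingToFirstOrderAtZero n p)) := by
  have hq : ENNReal.ofReal p.toReal = p := ENNReal.ofReal_toReal hp
  have hn2 : (n : ℝ≥0∞) / 2 = ENNReal.ofReal ((n : ℝ) / 2) := by
    rw [ENNReal.ofReal_div_of_pos two_pos, ENNReal.ofReal_natCast, ENNReal.ofReal_ofNat]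
  have hn1 : (n : ℝ≥0∞) = ENNReal.ofReal (n : ℝ) := (ENNReal.ofReal_natCast n).symm
  have hq0 : 0 < p.toReal := ENNReal.toReal_pos (zero_lt_one.trans hp1).ne' hp
  have hle2 : p ≤ (n : ℝ≥0∞) / 2 ↔ 2 * p.toReal ≤ n := by
    rw [hn2, ← hq, ENNReal.ofReal_le_ofReal_iff (by positivity), ENNReal.toReal_ofReal hq0.le,
      le_div_iff₀ two_pos, mul_comm]
  have hle1 : p ≤ (n : ℝ≥0∞) ↔ p.toReal ≤ n := by
    rw [hn1, ← hq, ENNReal.ofReal_le_ofReal_iff (by positivity), ENNReal.toReal_ofReal hq0.le]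
  refine ⟨fun h => ?_, fun h h' => ?_, fun h => ?_⟩
  · have hcl := SobolevSpace.closure_testFunctions_punctured_eq_univ hn hp1 hp (hle2.1 h)
    exact ⟨hcl, by rw [SobolevSpace.sobolevZero_punctured hn, hcl]⟩
  · have hlt : (n : ℝ) < 2 * p.toReal := not_le.1 fun hc => not_le.2 h (hle2.2 hc)
    have hcl := SobolevSpace.closure_testFunctions_punctured_eq_vanishingAtZero hn hp1 hp hlt
      (hle1.1 h')
    exact ⟨SobolevSpace.existsUnique_continuous_representative hp hlt, hcl,
      by rw [SobolevSpace.sobolevZero_punctured hn, hcl]⟩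
  · have hlt : (n : ℝ) < p.toReal := not_le.1 fun hc => not_le.2 h (hle1.2 hc)
    have hcl := SobolevSpace.closure_testFunctions_punctured_eq_vanishingToFirstOrderAtZero hn
      hp1 hp hlt
    exact ⟨SobolevSpace.existsUnique_contDiff_representative hp hlt, hcl,
      by rw [SobolevSpace.sobolevZero_punctured hn, hcl]⟩
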